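/- Let $\beta>0$, $h\in\mathbb R$, $S\in(-1,1)$ and $0\le p<\tfrac12$. For each $n$ let $A_n$ be the symmetric $0/1$ adjacency matrix of one of the following graphs on $n$ vertices: the Empty graph (no edges), the Chain (the path through all vertices), or the Ring (the cycle through all vertices). Let $\mathbf X=(X_1,\dots,X_n)\in\{-1,1\}^n$ have the Ising law $$p(\mathbf x)=\frac{\exp\left(\beta\,\mathbf x^TA_n\mathbf x+h\,\mathbf 1^T\mathbf x\right)}{Z_n(\beta,h)},\qquad Z_n(\beta,h)=\sum_{\mathbf x\in\{-1,1\}^n}\exp\left(\beta\,\mathbf x^TA_n\mathbf x+h\,\mathbf 1^T\mathbf x\right),$$ and, given $\mathbf X$, let $Y_1,\dots,Y_n\in\{-1,1\}$ be independent with $\mathbb P(Y_i\ne X_i\mid\mathbf X)=p$. Put $\overline{X_n}=\frac1n\sum_iX_i$, $\overline{Y_n}=\frac1n\sum_iY_i$ and $$P_e^{(n)}=\mathbb P\left(\operatorname{sign}(\overline{X_n}-S)\ne\operatorname{sign}(\overline{Y_n}-(1-2p)S)\right),\qquad \operatorname{sign}(0)=0.$$ Let $D_p=\frac{1-2p}{\sqrt{4p(1-p)}}$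 for $p>0$, and let $\operatorname{arccot}$ take values in $(0,\pi)$. Then the limits $$\psi(\beta,h)=\lim_{n\to\infty}\tfrac1n\log Z_n(\beta,h),\qquad \mu_{\beta,h}=\lim_{n\to\infty}\mathbb E[\overline{X_n}],\qquad \sigma^2_{\beta,h}=\lim_{n\to\infty}n\,\mathbb V[\overline{X_n}]$$ exist, $\mu_{\beta,h}=\partial_h\psi(\beta,h)$, $\sigma^2_{\beta,h}=\partial_h^2\psi(\beta,h)$, and they are given as follows. * Empty graph: $\psi=\log(2\cosh h)$, $\mu_{\beta,h}=\tanh h$, $\sigma^2_{\beta,h}=\dfrac1{\cosh^2h}$. * Chain and Ring: $\psi=2\beta+\log\left(\cosh h+\sqrt{\sinh^2h+e^{-8\beta}}\right)$, $\mu_{\beta,h}=\dfrac{\sinh h}{\sqrt{\sinh^2h+e^{-8\beta}}}$, $\sigma^2_{\beta,h}=\dfrac{e^{-8\beta}\cosh h}{(\sinh^2h+e^{-8\beta})^{3/2}}$. (The form $\mathbf x^TA_n\mathbf x$ counts each edge twice. If each edge is counted once, that is, if the exponent is $\frac\beta2\mathbf x^TA_n\mathbf x+h\mathbf 1^T\mathbf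 x$, then $2\beta$ and $e^{-8\beta}$ are to be replaced by $\beta$ and $e^{-4\beta}$.) Moreover: (a) If $S\ne\mu_{\beta,h}$, then $\lim_{n\to\infty}P_e^{(n)}=0$ and $\limsup_{n\to\infty}\frac1n\log P_e^{(n)}<0$ (with $\log0=-\infty$). (b) If $p>0$ and $S=\mu_{\beta,h}$, then $\lim_{n\to\infty}P_e^{(n)}=\frac1\pi\operatorname{arccot}(D_p\,\sigma_{\beta,h})>0$. -/

import Mathlib

open Filter Topology Matrix

noncomputable section

namespace SentimentDetection

/-- The three sequences of graphs. -/
inductive Network where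
  | empty
  | chain
  | ring

/-- The `n`-th graph of the sequence, on the `n` members `Fin n`: no edges, the path
`0 - 1 - ... - (n-1)`, or the cycle through all members. -/
def Network.graph (F : Network) (n : ℕ) : SimpleGraph (Fin n) :=
  match F with
  | .empty => ⊥
  | .chain => SimpleGraph.pathGraph n
  | .ring => SimpleGraph.cycleGraph n

open Classical in
/-- The symmetric 0/1 adjacency matrix of the `n`-th graph. -/
def Network.adjacency (F : Network) (n : ℕ) : Matrix (Fin n) (Fin n) ℝ :=
  (F.graph n).adjMatrix ℝ

/-- Configurations of `n` binary sentiments; `ℤˣ` is the set `{1, -1}`. -/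
abbrev Config (n : ℕ) : Type := Fin n → ℤˣ

/-- A configuration as a real vector. -/
def Config.vec {n : ℕ} (x : Config n) : Fin n → ℝ := fun i => ((x i : ℤ) : ℝ)

/-- The average sentiment `(1/n) ∑ x_i`. -/
def Config.avg {n : ℕ} (x : Config n) : ℝ := (∑ i, x.vec i) / n

/-- The unnormalized Ising weight `exp (β xᵀ A x + h 1ᵀ x)`. -/
def isingWeight {n : ℕ} (A : Matrix (Fin n) (Fin n) ℝ) (β h : ℝ) (x : Config n) : ℝ :=
  Real.exp (β * (x.vec ⬝ᵥ (A *ᵥ x.vec)) + h * ((1 : Fin n → ℝ) ⬝ᵥ x.vec))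

/-- The partition function `Z_n(β, h)`. -/
def partitionFunction {n : ℕ} (A : Matrix (Fin n) (Fin n) ℝ) (β h : ℝ) : ℝ :=
  ∑ x : Config n, isingWeight A β h x

/-- The Ising prior probability of a configuration. -/
def isingPrior {n : ℕ} (A : Matrix (Fin n) (Fin n) ℝ) (β h : ℝ) (x : Config n) : ℝ :=
  isingWeight A β h x / partitionFunction A β h

/-- The free entropy density at size `n`: `(1/n) log Z_n(β, h)`. -/
def freeEntropy {n : ℕ} (A : Matrix (Fin n) (Fin n) ℝ) (β h : ℝ) : ℝ :=
  1 / (n : ℝ) * Real.log (partitionFunction A β h)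

/-- The mean of the average sentiment under the Ising prior. -/
def avgMean {n : ℕ} (A : Matrix (Fin n) (Fin n) ℝ) (β h : ℝ) : ℝ :=
  ∑ x : Config n, isingPrior A β h x * x.avg

/-- The variance of the average sentiment under the Ising prior. -/
def avgVariance {n : ℕ} (A : Matrix (Fin n) (Fin n) ℝ) (β h : ℝ) : ℝ :=
  ∑ x : Config n, isingPrior A β h x * (x.avg - avgMean A β h) ^ 2

/-- The transition probability of `n` independent uses of the binary symmetric channel
with cross-over probability `p`: the law of the measurements `y` given the sentiments `x`. -/
def channel {n : ℕ} (p : ℝ) (x y : Config n) : ℝ :=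
  ∏ i, if y i = x i then 1 - p else p

/-- The supermajority sentiment `sign (X̄ - S)`. -/
def supermajority {n : ℕ} (S : ℝ) (x : Config n) : SignType :=
  SignType.sign (x.avg - S)

/-- The detector `sign (Ȳ - (1 - 2 p) S)`. -/
def detector {n : ℕ} (p S : ℝ) (y : Config n) : SignType :=
  SignType.sign (y.avg - (1 - 2 * p) * S)

/-- The detection error probability: the probability that the detector, applied to the
measurements, differs from the supermajority sentiment. A tie has sign `0`, so a tie on one
side only is an error. -/
def errorProb {n : ℕ} (A : Matrix (Fin n) (Fin n) ℝ) (β h p S : ℝ) : ℝ :=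
  ∑ x : Config n, ∑ y : Config n,
    if supermajority S x ≠ detector p S y then isingPrior A β h x * channel p x y else 0

/-- The constant `D_p = (1 - 2p) / √(4 p (1 - p))`. -/
def noiseRatio (p : ℝ) : ℝ := (1 - 2 * p) / Real.sqrt (4 * p * (1 - p))

/-- The inverse cotangent with values in `(0, π)`. -/
def arccot (x : ℝ) : ℝ := Real.pi / 2 - Real.arctan x

/-- The limiting free entropy density, when each edge `{i, j}` contributes `J x_i x_j` to the
exponent of the prior. -/
def Network.psi (F : Network) (J h : ℝ) : ℝ :=
  match F with
  | .empty => Real.log (2 * Real.cosh h)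
  | .chain | .ring =>
      J + Real.log (Real.cosh h + Real.sqrt (Real.sinh h ^ 2 + Real.exp (-4 * J)))

/-- The limiting mean, when each edge `{i, j}` contributes `J x_i x_j` to the exponent. -/
def Network.mu (F : Network) (J h : ℝ) : ℝ :=
  match F with
  | .empty => Real.tanh h
  | .chain | .ring => Real.sinh h / Real.sqrt (Real.sinh h ^ 2 + Real.exp (-4 * J))

/-- The limiting normalized variance, when each edge `{i, j}` contributes `J x_i x_j` to the
exponent. -/
def Network.sigmaSq (F : Network) (J h : ℝ) : ℝ :=
  match F with
  | .empty => 1 / Real.cosh h ^ 2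
  | .chain | .ring =>
      Real.exp (-4 * J) * Real.cosh h /
        (Real.sinh h ^ 2 + Real.exp (-4 * J)) ^ (3 / 2 : ℝ)

end SentimentDetection

end

/-! The partition function is extended to complex fields `z`. For each network it has the form `a(z)
λ(z)^n + b(z) λ'(z)^n` for large `n`, with `|λ'| < |λ|` near the real point `h`: for the empty graph
`λ = 2 cosh z` and the second term is absent; for chain and ring `λ, λ'` are the eigenvalues of the
2×2 transfer matrix. So `Z_n / λ^n` converges locally uniformly to a holomorphic function that does
not vanish at `h` (`IsQuasiPower`). Such convergence passes to derivatives, whence `ψ = log λ`, `μ =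
ψ'` and `σ² = ψ''`; with a second-order Taylor expansion it also gives a central limit theorem
(`IsQuasiPower.tendsto_ratio`).

The channel fits into this picture because, given `x`, the expectation of `exp (t ∑ y_i)` is a
product of two possible values, hence equals `exp (n l + s ∑ x_i)`: averaging over the noise only
shifts the field from `h` to `h + s`.

(a) If `S ≠ μ`, an error forces `X̄` to the wrong side of `S` or `Ȳ` to the wrong side of `(1 - 2p)
S`, ties included. Chernoff bounds make both events exponentially rare (`Network.errorProb_le_exp`).

(b) If `S = μ`, consider `u = √n (X̄ - μ) / σ` and `v = √n (Ȳ - (1 - 2p) X̄) / τ` with `τ² =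
4p(1-p)`. Their joint characteristic function tends to that of two independent standard Gaussians.
An error means that `u` and `c u + v` have different signs, where `c = D_p σ`. Up to a null set this
is a double wedge with two angles `arccot c`, of Gaussian mass `arccot c / π`. -/

open Filter Topology Matrix

noncomputable section

namespace SentimentDetection

/-! ### Complex partition functions and the transfer matrix -/

/-- The Ising partition function at a complex magnetic field. -/
def complexPartition {n : ℕ} (A : Matrix (Fin n) (Fin n) ℝ) (β : ℝ) (z : ℂ) : ℂ :=
  ∑ x : Config n, Complex.exp
    (((β * (x.vec ⬝ᵥ (A *ᵥ x.vec)) : ℝ) : ℂ) + z * ((∑ i, x.vec i : ℝ) : ℂ))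

lemma isingWeight_eq {n : ℕ} (A : Matrix (Fin n) (Fin n) ℝ) (β h : ℝ) (x : Config n) :
    isingWeight A β h x = Real.exp (β * (x.vec ⬝ᵥ (A *ᵥ x.vec)) + h * ∑ i, x.vec i) := by
  simp [isingWeight, dotProduct]

lemma complexPartition_ofReal {n : ℕ} (A : Matrix (Fin n) (Fin n) ℝ) (β h : ℝ) :
    complexPartition A β h = (partitionFunction A β h : ℝ) := by
  simp [complexPartition, partitionFunction, isingWeight_eq]

open Classical in
lemma Network.adjacency_apply (F : Network) (n : ℕ) (i j : Fin n) :
    F.adjacency n i j = if (F.graph n).Adj i j then 1 else 0 := rfl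

lemma sum_intUnits {M : Type*} [AddCommMonoid M] (f : ℤˣ → M) : ∑ a, f a = f 1 + f (-1) := by
  rw [UnitsInt.univ, Finset.sum_pair (by decide)]

/-- A sum of products over the sites factorizes. -/
lemma sum_prod_config {R : Type*} [CommSemiring R] {n : ℕ} (f : Fin n → ℤˣ → R) :
    ∑ x : Config n, ∏ i, f i (x i) = ∏ i, (f i 1 + f i (-1)) := by
  simp_rw [← sum_intUnits]
  rw [Finset.prod_univ_sum, Fintype.piFinset_univ]

lemma complexPartition_empty (n : ℕ) (β : ℝ) (z : ℂ) :
    complexPartition (Network.empty.adjacency n) β z = (2 * Complex.cosh z) ^ n := by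
  have h : ∀ x : Config n, Complex.exp
      (((β * (x.vec ⬝ᵥ (Network.empty.adjacency n *ᵥ x.vec)) : ℝ) : ℂ)
        + z * ((∑ i, x.vec i : ℝ) : ℂ)) = ∏ i, Complex.exp (z * ((x i : ℤ) : ℂ)) := by
    intro x
    have : Network.empty.adjacency n = 0 := by
      ext i j
      rw [Network.adjacency_apply, if_neg (by simp [Network.graph]), Matrix.zero_apply]
    simp [this, Config.vec, ← Complex.exp_sum, Finset.mul_sum]
  simp_rw [complexPartition, h]
  rw [sum_prod_config fun (_ : Fin n) a => Complex.exp (z * ((a : ℤ) : ℂ))]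
  simp [Complex.cosh]
  ring

/-- Powers of a transfer matrix are sums over paths. -/
lemma sum_path {R α : Type*} [CommSemiring R] [Fintype α] [DecidableEq α] (T : Matrix α α R)
    (g : α → R) (n : ℕ) (f : α → R) :
    ∑ x : Fin (n + 1) → α, f (x 0) * (∏ i : Fin n, T (x i.castSucc) (x i.succ)) * g (x (Fin.last n))
      = f ⬝ᵥ ((T ^ n) *ᵥ g) := by
  induction n generalizing f with
  | zero =>
    rw [← (Equiv.funUnique (Fin 1) α).symm.sum_comp]
    simp [dotProduct]
  | succ n ih =>
    rw [← (Fin.consEquiv fun _ => α).sum_comp, Fintype.sum_prod_type, Finset.sum_comm]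
    -- Summing over the first vertex absorbs it into the left boundary vector, hence the induction
    -- over all `f`.
    have := ih (f ᵥ* T)
    rw [pow_succ', ← mulVec_mulVec, dotProduct_mulVec, ← this]
    refine Finset.sum_congr rfl fun y _ => ?_
    simp only [vecMul, dotProduct, Finset.sum_mul, Fin.consEquiv_apply, Fin.prod_univ_succ]
    refine Finset.sum_congr rfl fun a _ => ?_
    simp [Fin.cons_zero, ← Fin.succ_last, mul_assoc]

/-- Traces of powers of a transfer matrix are sums over closed paths. -/
lemma sum_closed_path {R α : Type*} [CommSemiring R] [Fintype α] [DecidableEq α] (T : Matrix α α R)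
    (n : ℕ) :
    ∑ x : Fin (n + 1) → α, (∏ i : Fin n, T (x i.castSucc) (x i.succ)) * T (x (Fin.last n)) (x 0)
      = trace (T ^ (n + 1)) := by
  -- Pinning the first vertex at `a` by an indicator turns the closing edge into a right boundary
  -- vector, so `sum_path` applies.
  have h : ∀ x : Fin (n + 1) → α,
      (∏ i : Fin n, T (x i.castSucc) (x i.succ)) * T (x (Fin.last n)) (x 0)
      = ∑ a, (Pi.single a 1 : α → R) (x 0) * (∏ i : Fin n, T (x i.castSucc) (x i.succ))
          * T (x (Fin.last n)) a := by
    intro x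
    simp [Pi.single_apply]
  simp_rw [h]
  rw [Finset.sum_comm]
  simp_rw [fun a => sum_path T (fun b => T b a) n (Pi.single a 1), pow_succ]
  simp [trace, mul_apply, mulVec, dotProduct, Pi.single_apply]

/-- The symmetric form sees each edge in both orientations; this is the origin of the coupling `2 *
β`. -/
lemma quadratic_chain (n : ℕ) (v : Fin (n + 1) → ℝ) :
    v ⬝ᵥ (Network.chain.adjacency (n + 1) *ᵥ v) = 2 * ∑ i : Fin n, v i.castSucc * v i.succ := by
  classical
  have h1 : ∀ i j : Fin (n + 1), Network.chain.adjacency (n + 1) i j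
      = (if (i : ℕ) + 1 = j then 1 else 0) + if (j : ℕ) + 1 = i then 1 else 0 := by
    intro i j
    have hadj : (Network.chain.graph (n + 1)).Adj i j ↔ (i : ℕ) + 1 = j ∨ (j : ℕ) + 1 = i :=
      SimpleGraph.pathGraph_adj
    rw [Network.adjacency_apply]
    simp only [hadj]
    split_ifs <;> first | omega | simp
  have h2 : ∑ i : Fin (n + 1), ∑ j : Fin (n + 1), (if (i : ℕ) + 1 = j then v i * v j else 0)
      = ∑ i : Fin n, v i.castSucc * v i.succ := by
    rw [Fin.sum_univ_castSucc]
    have : ∀ j : Fin (n + 1), ¬ n + 1 = (j : ℕ) := fun j => by omega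
    simp only [Fin.val_castSucc, Fin.val_last, this, if_false, Finset.sum_const_zero, add_zero]
    refine Finset.sum_congr rfl fun i _ => ?_
    rw [Finset.sum_eq_single i.succ]
    · simp
    · intro j _ hj
      rw [if_neg]
      rintro h
      exact hj (Fin.ext (by simp [← h]))
    · simp
  have h3 : ∑ i : Fin (n + 1), ∑ j : Fin (n + 1), (if (j : ℕ) + 1 = i then v i * v j else 0)
      = ∑ i : Fin n, v i.castSucc * v i.succ := by
    rw [← h2, Finset.sum_comm]
    simp_rw [mul_comm]
  rw [two_mul]
  nth_rw 1 [← h2]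
  rw [← h3, ← Finset.sum_add_distrib]
  simp_rw [dotProduct, mulVec, dotProduct, Finset.mul_sum, h1, ← Finset.sum_add_distrib]
  refine Finset.sum_congr rfl fun i _ => Finset.sum_congr rfl fun j _ => ?_
  split_ifs <;> ring

/-- At least three vertices are needed: only then is `1 + 1 ≠ 0`, so that `i + 1 = j` and `j + 1 =
i` exclude each other and the two orientations of an edge are distinct. -/
lemma quadratic_ring (n : ℕ) (v : Fin (n + 3) → ℝ) :
    v ⬝ᵥ (Network.ring.adjacency (n + 3) *ᵥ v)
      = 2 * (∑ i : Fin (n + 2), v i.castSucc * v i.succ + v (Fin.last (n + 2)) * v 0) := by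
  classical
  have h1 : ∀ i j : Fin (n + 3), Network.ring.adjacency (n + 3) i j
      = (if i + 1 = j then 1 else 0) + if j + 1 = i then 1 else 0 := by
    intro i j
    have hadj : (Network.ring.graph (n + 3)).Adj i j ↔ i - j = 1 ∨ j - i = 1 :=
      SimpleGraph.cycleGraph_adj
    have e1 : j - i = 1 ↔ i + 1 = j := by rw [sub_eq_iff_eq_add', eq_comm]
    have e2 : i - j = 1 ↔ j + 1 = i := by rw [sub_eq_iff_eq_add', eq_comm]
    rw [e1, e2] at hadj
    rw [Network.adjacency_apply]
    simp only [hadj]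
    have : ¬ (i + 1 = j ∧ j + 1 = i) := by
      rintro ⟨rfl, h⟩
      have : (1 + 1 : Fin (n + 3)) = 0 := by
        rw [add_assoc] at h
        simpa using h
      have := congrArg Fin.val this
      rw [Fin.val_add, Fin.val_one, Fin.val_zero, Nat.mod_eq_of_lt (by omega)] at this
      omega
    split_ifs <;> first | tauto | simp
  have h2 : ∑ i : Fin (n + 3), v i * v (i + 1)
      = ∑ i : Fin (n + 2), v i.castSucc * v i.succ + v (Fin.last (n + 2)) * v 0 := by
    rw [Fin.sum_univ_castSucc]
    simp
  rw [← h2]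
  simp_rw [dotProduct, mulVec, dotProduct, Finset.mul_sum, h1]
  have h3 : ∀ i j : Fin (n + 3), v i * (((if i + 1 = j then 1 else 0) + if j + 1 = i then 1 else 0)
      * v j) = (if i + 1 = j then v i * v j else 0) + if j + 1 = i then v i * v j else 0 := by
    intro i j
    split_ifs <;> ring
  simp_rw [h3, Finset.sum_add_distrib]
  rw [Finset.sum_comm (f := fun i j : Fin (n + 3) => if j + 1 = i then v i * v j else 0)]
  simp only [Finset.sum_ite_eq, Finset.mem_univ, if_true]
  rw [← Finset.sum_add_distrib]
  exact Finset.sum_congr rfl fun i _ => by ring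

/-- The transfer matrix of the one-dimensional Ising model. -/
def transfer (J : ℝ) (z : ℂ) : Matrix ℤˣ ℤˣ ℂ :=
  of fun a b => Complex.exp (J * ((a : ℤ) * (b : ℤ)) + z * (b : ℤ))

/-- Each factor of `transfer` carries the field of the vertex it arrives at. The first vertex of the
chain is never arrived at, so its field sits in the left vector; on the ring nothing is left over.
-/
lemma complexPartition_chain (n : ℕ) (β : ℝ) (z : ℂ) :
    complexPartition (Network.chain.adjacency (n + 1)) β z
      = (fun a : ℤˣ => Complex.exp (z * (a : ℤ))) ⬝ᵥ ((transfer (2 * β) z ^ n) *ᵥ 1) := by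
  rw [← sum_path]
  refine Finset.sum_congr rfl fun x _ => ?_
  simp only [quadratic_chain, transfer, of_apply, ← Complex.exp_sum, ← Complex.exp_add, Config.vec,
    Pi.one_apply, mul_one]
  congr 1
  push_cast
  rw [Fin.sum_univ_succ, Finset.sum_add_distrib]
  simp only [← Finset.mul_sum]
  ring

lemma complexPartition_ring (n : ℕ) (β : ℝ) (z : ℂ) :
    complexPartition (Network.ring.adjacency (n + 3)) β z = trace (transfer (2 * β) z ^ (n + 3)) := by
  rw [← sum_closed_path]
  refine Finset.sum_congr rfl fun x _ => ?_
  simp only [quadratic_ring, transfer, of_apply, ← Complex.exp_sum, ← Complex.exp_add, Config.vec]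
  congr 1
  push_cast
  rw [Fin.sum_univ_succ (fun i => ((x i : ℤ) : ℂ)), Finset.sum_add_distrib]
  simp only [← Finset.mul_sum]
  ring

/-- Cayley–Hamilton: the coefficients are trace and determinant. Hence both `f ⬝ᵥ (T ^ n *ᵥ g)` and
`trace (T ^ n)` obey a recurrence of order two. -/
lemma transfer_sq (J : ℝ) (z : ℂ) :
    transfer J z ^ 2 = (2 * Complex.exp J * Complex.cosh z) • transfer J z
      - (Complex.exp (2 * J) - Complex.exp (-(2 * J))) • (1 : Matrix ℤˣ ℤˣ ℂ) := by
  have e1 : Complex.exp (2 * J) = Complex.exp J ^ 2 := by rw [← Complex.exp_nat_mul]; simp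
  have e2 : Complex.exp (-(2 * J)) = (Complex.exp J)⁻¹ ^ 2 := by
    rw [← Complex.exp_neg, ← Complex.exp_nat_mul]; simp
  have h0 := Complex.exp_ne_zero J
  have h1 := Complex.exp_ne_zero z
  ext a b
  rw [pow_two, mul_apply, sum_intUnits]
  rcases Int.units_eq_one_or a with rfl | rfl <;> rcases Int.units_eq_one_or b with rfl | rfl <;>
    simp [transfer, Complex.cosh, Complex.exp_add, Complex.exp_neg, e1, one_apply] <;>
    field_simp <;> ring_nf

/-! ### Quasi-powers and the eigenvalues of the transfer matrix -/

/-- Solution of a linear recurrence of order two with distinct characteristic roots. -/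
lemma recurrence_solution {K : Type*} [Field K] {u : ℕ → K} {x y : K}
    (h : ∀ n, u (n + 2) = (x + y) * u (n + 1) - x * y * u n) (n : ℕ) :
    (x - y) * u n = (u 1 - y * u 0) * x ^ n - (u 1 - x * u 0) * y ^ n := by
  induction n using Nat.twoStepInduction with
  | zero => simp; ring
  | one => simp; ring
  | more n h1 h2 =>
    rw [h]
    linear_combination (x + y) * h2 - x * y * h1

/-- The functions `Z n` behave near `z₀` like the powers of a holomorphic function `lam` with
logarithmic derivative `m`, whose derivative in turn is `s`. -/
def IsQuasiPower (Z : ℕ → ℂ → ℂ) (lam m s : ℂ → ℂ) (z₀ : ℂ) : Prop :=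
  ∃ U : Set ℂ, IsOpen U ∧ z₀ ∈ U ∧
    (∀ z ∈ U, lam z ≠ 0 ∧ HasDerivAt lam (lam z * m z) z ∧ HasDerivAt m (s z) z) ∧
    ∃ A : ℂ → ℂ, TendstoLocallyUniformlyOn (fun n z => Z n z / lam z ^ n) A atTop U ∧ A z₀ ≠ 0

/-- By continuity, `|λ'/λ| < ρ < 1` and `|b| < |b z₀| + 1` on a neighbourhood of `z₀`, so the second
term divided by `λ^n` vanishes uniformly there. The expansion is required only for large `n` because
small chains and rings are irregular. -/
lemma isQuasiPower_of_two_terms {Z : ℕ → ℂ → ℂ} {lam lam' m s a b : ℂ → ℂ} {z₀ : ℂ} {U : Set ℂ}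
    (hU : IsOpen U) (hz₀ : z₀ ∈ U)
    (hd : ∀ z ∈ U, lam z ≠ 0 ∧ HasDerivAt lam (lam z * m z) z ∧ HasDerivAt m (s z) z)
    (hlam' : ContinuousOn lam' U) (hb : ContinuousOn b U)
    (hlt : ‖lam' z₀‖ < ‖lam z₀‖) (ha : a z₀ ≠ 0)
    (hZ : ∀ᶠ n in atTop, ∀ z ∈ U, Z n z = a z * lam z ^ n + b z * lam' z ^ n) :
    IsQuasiPower Z lam m s z₀ := by
  have hlam : ContinuousOn lam U := fun z hz => (hd z hz).2.1.continuousAt.continuousWithinAt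
  have hpos : 0 < ‖lam z₀‖ := norm_pos_iff.2 (hd z₀ hz₀).1
  obtain ⟨ρ, hρ1, hρ2⟩ := exists_between ((div_lt_one hpos).2 hlt)
  have hρ0 : 0 ≤ ρ := (div_nonneg (norm_nonneg _) (norm_nonneg _)).trans hρ1.le
  have hr : ContinuousOn (fun z => ‖lam' z / lam z‖) U :=
    (hlam'.div hlam fun z hz => (hd z hz).1).norm
  have hV1 := hr.isOpen_inter_preimage hU (isOpen_Iio (a := ρ))
  have hV2 := hb.norm.isOpen_inter_preimage hU (isOpen_Iio (a := ‖b z₀‖ + 1))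
  refine ⟨_, hV1.inter hV2, ⟨⟨hz₀, ?_⟩, hz₀, ?_⟩, fun z hz => hd z hz.1.1, a, ?_, ha⟩
  · simpa using hρ1
  · simp
  refine TendstoUniformlyOn.tendstoLocallyUniformlyOn ?_
  rw [Metric.tendstoUniformlyOn_iff]
  intro ε hε
  have hlim : Tendsto (fun n : ℕ => (‖b z₀‖ + 1) * ρ ^ n) atTop (𝓝 0) := by
    simpa using (tendsto_pow_atTop_nhds_zero_of_lt_one hρ0 hρ2).const_mul (‖b z₀‖ + 1)
  filter_upwards [hZ, hlim.eventually_lt_const hε] with n hn hlt z hz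
  refine lt_of_le_of_lt ?_ hlt
  have hne := (hd z hz.1.1).1
  rw [hn z hz.1.1, dist_comm, dist_eq_norm]
  have : (a z * lam z ^ n + b z * lam' z ^ n) / lam z ^ n - a z = b z * (lam' z / lam z) ^ n := by
    rw [div_pow]
    field_simp
    ring
  rw [this, norm_mul, norm_pow]
  have h1 : ‖b z‖ < ‖b z₀‖ + 1 := hz.2.2
  have h2 : ‖lam' z / lam z‖ < ρ := hz.1.2
  gcongr

lemma cosh_ofReal_ne_zero (h : ℝ) : Complex.cosh h ≠ 0 := by
  rw [← Complex.ofReal_cosh]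
  exact_mod_cast (Real.cosh_pos h).ne'

lemma isQuasiPower_empty (β h : ℝ) :
    IsQuasiPower (fun n => complexPartition (Network.empty.adjacency n) β)
      (fun z => 2 * Complex.cosh z) (fun z => Complex.sinh z / Complex.cosh z)
      (fun z => 1 / Complex.cosh z ^ 2) h := by
  refine isQuasiPower_of_two_terms (lam' := fun _ => 0) (a := fun _ => 1) (b := fun _ => 0)
    (U := {z | Complex.cosh z ≠ 0}) (isOpen_ne_fun (by fun_prop) (by fun_prop))
    (cosh_ofReal_ne_zero h) (fun z hz => ⟨?_, ?_, ?_⟩) (by fun_prop) (by fun_prop) ?_ (by simp)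
    (Eventually.of_forall fun n z _ => ?_)
  · exact mul_ne_zero two_ne_zero hz
  · have hz : Complex.cosh z ≠ 0 := hz
    refine ((Complex.hasDerivAt_cosh z).const_mul 2).congr_deriv ?_
    field_simp
  · have hz : Complex.cosh z ≠ 0 := hz
    refine ((Complex.hasDerivAt_sinh z).div (Complex.hasDerivAt_cosh z) hz).congr_deriv ?_
    congr 1
    linear_combination Complex.cosh_sq_sub_sinh_sq z
  · simpa using cosh_ofReal_ne_zero h
  · simp [complexPartition_empty]

/-- The discriminant of the transfer matrix, up to a factor. -/
def disc (J : ℝ) (z : ℂ) : ℂ := Complex.sinh z ^ 2 + Complex.exp (-4 * J)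

/-- The square root of `disc`. -/
def discSqrt (J : ℝ) (z : ℂ) : ℂ := disc J z ^ (1 / 2 : ℂ)

/-- The dominant eigenvalue of the transfer matrix. -/
def eigenvalueMax (J : ℝ) (z : ℂ) : ℂ := Complex.exp J * (Complex.cosh z + discSqrt J z)

/-- The other eigenvalue of the transfer matrix. -/
def eigenvalueMin (J : ℝ) (z : ℂ) : ℂ := Complex.exp J * (Complex.cosh z - discSqrt J z)

lemma discSqrt_sq (J : ℝ) (z : ℂ) : discSqrt J z ^ 2 = disc J z := by
  rw [discSqrt, ← Complex.cpow_nat_mul]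
  simp

lemma discSqrt_ne_zero {J : ℝ} {z : ℂ} (hz : disc J z ∈ Complex.slitPlane) : discSqrt J z ≠ 0 := by
  intro h
  have := discSqrt_sq J z
  rw [h] at this
  exact Complex.slitPlane_ne_zero hz (by rw [← this]; simp)

lemma hasDerivAt_discSqrt {J : ℝ} {z : ℂ} (hz : disc J z ∈ Complex.slitPlane) :
    HasDerivAt (discSqrt J) (Complex.sinh z * Complex.cosh z / discSqrt J z) z := by
  have h1 : HasDerivAt (disc J) (2 * Complex.sinh z * Complex.cosh z) z := by
    have := ((Complex.hasDerivAt_sinh z).pow 2).add_const (Complex.exp (-4 * J))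
    exact this.congr_deriv (by simp)
  have h2 := h1.cpow_const (c := 1 / 2) hz
  have h0 := discSqrt_ne_zero hz
  refine h2.congr_deriv ?_
  have : disc J z ^ ((1 / 2 : ℂ) - 1) = (discSqrt J z)⁻¹ := by
    rw [discSqrt, ← Complex.cpow_neg]
    norm_num
  rw [this]
  field_simp

/-- With `eigenvalue_mul`, Vieta's relations for the characteristic polynomial in `transfer_sq`,
whose discriminant is `4 e^{2J}` times `disc`. -/
lemma eigenvalue_add (J : ℝ) (z : ℂ) :
    eigenvalueMax J z + eigenvalueMin J z = 2 * Complex.exp J * Complex.cosh z := by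
  rw [eigenvalueMax, eigenvalueMin]
  ring

lemma eigenvalue_mul (J : ℝ) (z : ℂ) :
    eigenvalueMax J z * eigenvalueMin J z = Complex.exp (2 * J) - Complex.exp (-(2 * J)) := by
  have e1 : Complex.exp (2 * J) = Complex.exp J ^ 2 := by rw [← Complex.exp_nat_mul]; simp
  have e2 : Complex.exp (-(2 * J)) = Complex.exp J ^ 2 * Complex.exp (-4 * J) := by
    rw [← e1, ← Complex.exp_add]; congr 1; ring
  have h := discSqrt_sq J z
  have h2 := Complex.cosh_sq_sub_sinh_sq z
  rw [disc] at h
  rw [eigenvalueMax, eigenvalueMin, e1, e2]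
  linear_combination Complex.exp J ^ 2 * h2 - Complex.exp J ^ 2 * h

/-- The determinant `2 sinh (2J)` does not depend on `z`, so no eigenvalue vanishes at any complex
field. -/
lemma eigenvalue_mul_ne_zero {J : ℝ} (hJ : 0 < J) (z : ℂ) :
    eigenvalueMax J z * eigenvalueMin J z ≠ 0 := by
  rw [eigenvalue_mul]
  have : Real.exp (-(2 * J)) < Real.exp (2 * J) := Real.exp_lt_exp.2 (by linarith)
  have h2 : Real.exp (2 * J) - Real.exp (-(2 * J)) ≠ 0 := by linarith
  exact_mod_cast h2

lemma disc_ofReal (J h : ℝ) : disc J h = (Real.sinh h ^ 2 + Real.exp (-4 * J) : ℝ) := by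
  simp [disc]

lemma disc_real_pos (J h : ℝ) : 0 < Real.sinh h ^ 2 + Real.exp (-4 * J) := by positivity

lemma disc_ofReal_mem (J h : ℝ) : disc J h ∈ Complex.slitPlane := by
  rw [disc_ofReal, Complex.ofReal_mem_slitPlane]
  exact disc_real_pos J h

lemma discSqrt_ofReal (J h : ℝ) :
    discSqrt J h = (Real.sqrt (Real.sinh h ^ 2 + Real.exp (-4 * J)) : ℝ) := by
  rw [discSqrt, disc_ofReal, Real.sqrt_eq_rpow, Complex.ofReal_cpow (disc_real_pos J h).le]
  simp

lemma continuous_disc (J : ℝ) : Continuous (disc J) := by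
  unfold disc
  fun_prop

lemma isOpen_disc (J : ℝ) : IsOpen {z | disc J z ∈ Complex.slitPlane} :=
  Complex.isOpen_slitPlane.preimage (continuous_disc J)

/-- At a real field `cosh h` and the root `w` are both positive, so `|cosh h - w| < cosh h + w`. -/
lemma norm_eigenvalue_lt (J h : ℝ) : ‖eigenvalueMin J h‖ < ‖eigenvalueMax J h‖ := by
  have hc := Real.cosh_pos h
  have hs := Real.sqrt_pos.2 (disc_real_pos J h)
  rw [eigenvalueMin, eigenvalueMax, discSqrt_ofReal, ← Complex.ofReal_cosh, norm_mul, norm_mul,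
    ← Complex.ofReal_add, ← Complex.ofReal_sub, Complex.norm_real, Complex.norm_real]
  refine mul_lt_mul_of_pos_left ?_ (norm_pos_iff.2 (Complex.exp_ne_zero _))
  rw [Real.norm_eq_abs, Real.norm_eq_abs, abs_of_pos (a := Real.cosh h + _) (by positivity),
    abs_lt]
  constructor <;> linarith

/-- The sequence `u` is `Z` from index `k` on, where the recurrence is valid; the powers `λ^k`,
`λ'^k` in the coefficients undo the shift. Hypothesis `hne` says that the dominant mode is present.
-/
lemma isQuasiPower_of_recurrence {J : ℝ} (hJ : 0 < J) (h : ℝ) {Z : ℕ → ℂ → ℂ} {u : ℕ → ℂ → ℂ}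
    (k : ℕ) (hZ : ∀ n, Z (n + k) = u n) (hu0 : Continuous (u 0)) (hu1 : Continuous (u 1))
    (hu : ∀ n z, u (n + 2) z = 2 * Complex.exp J * Complex.cosh z * u (n + 1) z
      - (Complex.exp (2 * J) - Complex.exp (-(2 * J))) * u n z)
    (hne : u 1 h - eigenvalueMin J h * u 0 h ≠ 0) :
    IsQuasiPower Z (eigenvalueMax J) (fun z => Complex.sinh z / discSqrt J z)
      (fun z => Complex.exp (-4 * J) * Complex.cosh z / discSqrt J z ^ 3) h := by
  have hx (z : ℂ) : eigenvalueMax J z ≠ 0 := left_ne_zero_of_mul (eigenvalue_mul_ne_zero hJ z)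
  have hy (z : ℂ) : eigenvalueMin J z ≠ 0 := right_ne_zero_of_mul (eigenvalue_mul_ne_zero hJ z)
  have hsub (z : ℂ) : eigenvalueMax J z - eigenvalueMin J z
      = 2 * Complex.exp J * discSqrt J z := by
    rw [eigenvalueMax, eigenvalueMin]
    ring
  have hsub0 (z : ℂ) (hz : disc J z ∈ Complex.slitPlane) :
      eigenvalueMax J z - eigenvalueMin J z ≠ 0 := by
    rw [hsub]
    exact mul_ne_zero (mul_ne_zero two_ne_zero (Complex.exp_ne_zero _)) (discSqrt_ne_zero hz)
  have hw : ContinuousOn (discSqrt J) {z | disc J z ∈ Complex.slitPlane} :=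
    fun z hz => (hasDerivAt_discSqrt hz).continuousAt.continuousWithinAt
  have hcx : ContinuousOn (eigenvalueMax J) {z | disc J z ∈ Complex.slitPlane} := by
    unfold eigenvalueMax
    fun_prop
  have hcy : ContinuousOn (eigenvalueMin J) {z | disc J z ∈ Complex.slitPlane} := by
    unfold eigenvalueMin
    fun_prop
  have hpow (z : ℂ) (j : ℕ) : eigenvalueMin J z ^ j ≠ 0 := pow_ne_zero _ (hy z)
  refine isQuasiPower_of_two_terms (lam' := eigenvalueMin J)
    (a := fun z => (u 1 z - eigenvalueMin J z * u 0 z)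
      / ((eigenvalueMax J z - eigenvalueMin J z) * eigenvalueMax J z ^ k))
    (b := fun z => -(u 1 z - eigenvalueMax J z * u 0 z)
      / ((eigenvalueMax J z - eigenvalueMin J z) * eigenvalueMin J z ^ k))
    (isOpen_disc J) (disc_ofReal_mem J h) (fun z hz => ⟨hx z, ?_, ?_⟩) hcy ?_
    (norm_eigenvalue_lt J h) ?_ ?_
  · have hw0 := discSqrt_ne_zero hz
    refine (((Complex.hasDerivAt_cosh z).add (hasDerivAt_discSqrt hz)).const_mul
      (Complex.exp J)).congr_deriv ?_
    rw [eigenvalueMax]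
    field_simp
    ring
  · have hw0 := discSqrt_ne_zero hz
    refine ((Complex.hasDerivAt_sinh z).div (hasDerivAt_discSqrt hz) hw0).congr_deriv ?_
    have h1 := discSqrt_sq J z
    rw [disc, neg_mul] at h1
    field_simp
    linear_combination Complex.cosh z * h1
  · refine ContinuousOn.div ?_ ?_ fun z hz => mul_ne_zero (hsub0 z hz) (hpow z k)
    · exact (hu1.continuousOn.sub (hcx.mul hu0.continuousOn)).neg
    · exact (hcx.sub hcy).mul (hcy.pow k)
  · exact div_ne_zero hne (mul_ne_zero (hsub0 _ (disc_ofReal_mem J h)) (pow_ne_zero _ (hx _)))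
  · filter_upwards [eventually_ge_atTop k] with n hn z hz
    obtain ⟨j, rfl⟩ := Nat.exists_eq_add_of_le' hn
    have h1 := recurrence_solution (u := fun n => u n z) (x := eigenvalueMax J z)
      (y := eigenvalueMin J z) (fun n => by rw [hu, eigenvalue_add, eigenvalue_mul]) j
    have h2 := hsub0 z hz
    have h3 := hx z
    have h4 := hy z
    rw [hZ]
    rw [eq_comm, ← mul_right_inj' h2, h1]
    field_simp
    ring

lemma isQuasiPower_chain {β : ℝ} (hβ : 0 < β) (h : ℝ) :
    IsQuasiPower (fun n => complexPartition (Network.chain.adjacency n) β)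
      (eigenvalueMax (2 * β)) (fun z => Complex.sinh z / discSqrt (2 * β) z)
      (fun z => Complex.exp (-4 * (2 * β : ℝ)) * Complex.cosh z / discSqrt (2 * β) z ^ 3) h := by
  have u0 (z : ℂ) : complexPartition (Network.chain.adjacency (0 + 1)) β z
      = 2 * Complex.cosh z := by
    rw [complexPartition_chain]
    simp [dotProduct, Complex.cosh]
    ring
  have u1 (z : ℂ) : complexPartition (Network.chain.adjacency (1 + 1)) β z
      = 2 * Complex.exp (2 * β : ℝ) * Complex.cosh (2 * z) + 2 * Complex.exp (-(2 * β : ℝ)) := by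
    rw [complexPartition_chain]
    simp [dotProduct, Complex.cosh, mulVec, transfer, two_mul z, Complex.exp_add,
      Complex.exp_neg]
    have h1 := Complex.exp_ne_zero z
    field_simp
    ring
  refine isQuasiPower_of_recurrence (by positivity) h 1 (fun n => rfl) ?_ ?_ (fun n z => ?_) ?_
  · simp_rw [funext u0]
    fun_prop
  · simp_rw [funext u1]
    fun_prop
  · rw [complexPartition_chain, complexPartition_chain, complexPartition_chain, pow_add,
      transfer_sq, mul_sub, Matrix.mul_smul, Matrix.mul_smul, ← pow_succ, mul_one, sub_mulVec,
      smul_mulVec, smul_mulVec, dotProduct_sub, dotProduct_smul, dotProduct_smul]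
    simp
  · rw [u0, u1, eigenvalueMin, discSqrt_ofReal, ← Complex.ofReal_cosh]
    have e : Complex.cosh (2 * h) = (2 * Real.cosh h ^ 2 - 1 : ℝ) := by
      rw [Complex.cosh_two_mul, Complex.sinh_sq]
      push_cast
      ring
    rw [e]
    set w := Real.sqrt (Real.sinh h ^ 2 + Real.exp (-4 * (2 * β)))
    have hw : 0 < w := Real.sqrt_pos.2 (disc_real_pos _ h)
    have hc := Real.one_le_cosh h
    -- With `J = 2β` and `c = cosh h` this is `2 e^J (c² - 1) + 2 e^J w c + 2 e^{-J}`.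
    have : 0 < 2 * Real.exp (2 * β) * (2 * Real.cosh h ^ 2 - 1) + 2 * Real.exp (-(2 * β))
        - Real.exp (2 * β) * (Real.cosh h - w) * (2 * Real.cosh h) := by
      have h1 : 0 < Real.exp (2 * β) * w * Real.cosh h := by positivity
      have h2 : 0 ≤ Real.exp (2 * β) * (Real.cosh h ^ 2 - 1) :=
        mul_nonneg (Real.exp_pos _).le (by nlinarith)
      have h3 := Real.exp_pos (-(2 * β))
      nlinarith
    exact_mod_cast this.ne'

lemma isQuasiPower_ring {β : ℝ} (hβ : 0 < β) (h : ℝ) :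
    IsQuasiPower (fun n => complexPartition (Network.ring.adjacency n) β)
      (eigenvalueMax (2 * β)) (fun z => Complex.sinh z / discSqrt (2 * β) z)
      (fun z => Complex.exp (-4 * (2 * β : ℝ)) * Complex.cosh z / discSqrt (2 * β) z ^ 3) h := by
  have hc (n : ℕ) : Continuous fun z => trace (transfer (2 * β) z ^ n) := by
    have : Continuous (transfer (2 * β)) := by
      refine continuous_matrix fun a b => ?_
      simp only [transfer, of_apply]
      fun_prop
    fun_prop
  have hrec (n : ℕ) (z : ℂ) : trace (transfer (2 * β) z ^ (n + 2))
      = 2 * Complex.exp (2 * β : ℝ) * Complex.cosh z * trace (transfer (2 * β) z ^ (n + 1))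
        - (Complex.exp (2 * (2 * β : ℝ)) - Complex.exp (-(2 * (2 * β : ℝ))))
          * trace (transfer (2 * β) z ^ n) := by
    rw [pow_add, transfer_sq, mul_sub, Matrix.mul_smul, Matrix.mul_smul, ← pow_succ, mul_one,
      trace_sub, trace_smul, trace_smul, smul_eq_mul, smul_eq_mul]
  have t0 (z : ℂ) : trace (transfer (2 * β) z ^ 0) = 2 := by simp [trace]
  have t1 (z : ℂ) : trace (transfer (2 * β) z ^ 1)
      = eigenvalueMax (2 * β) z + eigenvalueMin (2 * β) z := by
    rw [eigenvalue_add]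
    simp [trace, transfer, Complex.cosh, Complex.exp_add]
    ring
  have ht (n : ℕ) (z : ℂ) : trace (transfer (2 * β) z ^ n)
      = eigenvalueMax (2 * β) z ^ n + eigenvalueMin (2 * β) z ^ n := by
    induction n using Nat.twoStepInduction with
    | zero => rw [t0]; norm_num
    | one => rw [t1]; simp
    | more n h1 h2 =>
      rw [hrec, h1, h2, ← eigenvalue_add, ← eigenvalue_mul]
      ring
  refine isQuasiPower_of_recurrence (u := fun n z => trace (transfer (2 * β) z ^ (n + 3)))
    (by positivity) h 3 (fun n => funext fun z => complexPartition_ring n β z) (hc _) (hc _)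
    (fun n z => hrec _ _) ?_
  -- The dominant coefficient is `λ³ (λ - λ')`, because `tr T^n = λ^n + λ'^n`.
  rw [ht, ht]
  have hx : eigenvalueMax (2 * β) h ≠ 0 :=
    left_ne_zero_of_mul (eigenvalue_mul_ne_zero (by positivity) (h : ℂ))
  have hxy : eigenvalueMax (2 * β) h - eigenvalueMin (2 * β) h ≠ 0 := by
    rw [sub_ne_zero]
    intro he
    exact (norm_eigenvalue_lt (2 * β) h).ne (by rw [he])
  have : eigenvalueMax (2 * β) h ^ (1 + 3) + eigenvalueMin (2 * β) h ^ (1 + 3)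
      - eigenvalueMin (2 * β) h * (eigenvalueMax (2 * β) h ^ (0 + 3)
        + eigenvalueMin (2 * β) h ^ (0 + 3))
      = eigenvalueMax (2 * β) h ^ 3 * (eigenvalueMax (2 * β) h - eigenvalueMin (2 * β) h) := by
    ring
  rw [this]
  exact mul_ne_zero (pow_ne_zero _ hx) hxy

/-! ### Asymptotics of quasi-powers -/

lemma IsQuasiPower.tendsto_log {Z : ℕ → ℂ → ℂ} {lam m s : ℂ → ℂ} {z₀ : ℂ}
    (H : IsQuasiPower Z lam m s z₀) :
    Tendsto (fun n : ℕ => 1 / (n : ℝ) * Real.log ‖Z n z₀‖) atTop (𝓝 (Real.log ‖lam z₀‖)) := by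
  obtain ⟨U, hU, hz₀, hd, A, hA, hA0⟩ := H
  have h0 := (hd z₀ hz₀).1
  have h1 := (hA.tendsto_at hz₀).norm.log (norm_ne_zero_iff.2 hA0)
  have h2 : Tendsto (fun n : ℕ => 1 / (n : ℝ) * Real.log ‖Z n z₀ / lam z₀ ^ n‖
      + Real.log ‖lam z₀‖) atTop (𝓝 (0 * Real.log ‖A z₀‖ + Real.log ‖lam z₀‖)) :=
    ((tendsto_one_div_atTop_nhds_zero_nat).mul h1).add_const _
  rw [zero_mul, zero_add] at h2
  refine h2.congr' ?_
  filter_upwards [(hA.tendsto_at hz₀).eventually_ne hA0, eventually_gt_atTop 0] with n hn hn0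
  have hZ : Z n z₀ ≠ 0 := fun h => hn (by rw [h, zero_div])
  rw [norm_div, norm_pow, Real.log_div (by simpa using hZ) (by positivity), Real.log_pow]
  have : (n : ℝ) ≠ 0 := by positivity
  field_simp
  ring

/-- The logarithmic derivatives of a quasi-power. -/
lemma IsQuasiPower.logDeriv_eq {Z : ℕ → ℂ → ℂ} {lam m s : ℂ → ℂ} {z₀ : ℂ}
    (H : IsQuasiPower Z lam m s z₀) (hZ : ∀ n, Differentiable ℂ (Z n)) :
    ∃ (c d : ℕ → ℂ) (c₀ d₀ : ℂ), Tendsto c atTop (𝓝 c₀) ∧ Tendsto d atTop (𝓝 d₀) ∧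
      ∀ᶠ n in atTop, logDeriv (Z n) z₀ = n * m z₀ + c n ∧
        deriv (logDeriv (Z n)) z₀ = n * s z₀ + d n := by
  obtain ⟨U, hU, hz₀, hd, A, hA, hA0⟩ := H
  set G : ℕ → ℂ → ℂ := fun n z => Z n z / lam z ^ n with hG
  have hGd (n : ℕ) : DifferentiableOn ℂ (G n) U := fun z hz =>
    ((hZ n z).div ((hd z hz).2.1.differentiableAt.pow n)
      (pow_ne_zero _ (hd z hz).1)).differentiableWithinAt
  -- Weierstrass, applied twice: locally uniform limits of holomorphic functions may be
  -- differentiated.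
  have hA1 := hA.deriv (Eventually.of_forall hGd) hU
  have hA2 := hA1.deriv (Eventually.of_forall fun n => (hGd n).deriv hU) hU
  have t0 := hA.tendsto_at hz₀
  have t1 := hA1.tendsto_at hz₀
  have t2 := hA2.tendsto_at hz₀
  refine ⟨fun n => deriv (G n) z₀ / G n z₀,
    fun n => (deriv (deriv (G n)) z₀ * G n z₀ - deriv (G n) z₀ * deriv (G n) z₀) / G n z₀ ^ 2,
    _, _, t1.div t0 hA0, ((t2.mul t0).sub (t1.mul t1)).div (t0.pow 2) (pow_ne_zero _ hA0), ?_⟩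
  filter_upwards [t0.eventually_ne hA0] with n hn
  have hUn : U ∈ 𝓝 z₀ := hU.mem_nhds hz₀
  have hGn : ∀ᶠ z in 𝓝 z₀, G n z ≠ 0 :=
    ((hGd n).differentiableAt hUn).continuousAt.eventually_ne hn
  have hev : logDeriv (Z n) =ᶠ[𝓝 z₀] fun z => n * m z + logDeriv (G n) z := by
    filter_upwards [hUn, hGn] with z hz hGz
    have hl := (hd z hz).1
    have hZG : Z n =ᶠ[𝓝 z] fun y => lam y ^ n * G n y := by
      filter_upwards [hU.mem_nhds hz] with y hy
      have := pow_ne_zero n (hd y hy).1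
      simp only [hG]
      field_simp
    have hlam : logDeriv lam z = m z := by
      rw [logDeriv_apply, (hd z hz).2.1.deriv]
      field_simp
    rw [logDeriv_apply, hZG.deriv_eq, hZG.eq_of_nhds, ← logDeriv_apply (f := fun y => lam y ^ n * G n y),
      logDeriv_mul (f := fun y => lam y ^ n) z (pow_ne_zero _ hl) hGz ((hd z hz).2.1.differentiableAt.pow n)
      ((hGd n).differentiableAt (hU.mem_nhds hz)), logDeriv_fun_pow (hd z hz).2.1.differentiableAt,
      hlam]
  refine ⟨hev.eq_of_nhds, ?_⟩
  have hD : DifferentiableAt ℂ (deriv (G n)) z₀ := ((hGd n).deriv hU).differentiableAt hUn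
  have h1 : HasDerivAt (logDeriv (G n)) ((deriv (deriv (G n)) z₀ * G n z₀
      - deriv (G n) z₀ * deriv (G n) z₀) / G n z₀ ^ 2) z₀ :=
    hD.hasDerivAt.div ((hGd n).differentiableAt hUn).hasDerivAt hn
  rw [hev.deriv_eq]
  exact (((hd z₀ hz₀).2.2.const_mul (n : ℂ)).add h1).deriv

lemma tendsto_one_div_mul_of_eventually_eq {f c : ℕ → ℂ} {a c₀ : ℂ} (hc : Tendsto c atTop (𝓝 c₀))
    (h : ∀ᶠ n : ℕ in atTop, f n = n * a + c n) :
    Tendsto (fun n : ℕ => 1 / (n : ℂ) * f n) atTop (𝓝 a) := by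
  have h2 : Tendsto (fun n : ℕ => a + 1 / (n : ℂ) * c n) atTop (𝓝 (a + 0 * c₀)) :=
    ((tendsto_one_div_atTop_nhds_zero_nat (𝕜 := ℂ)).mul hc).const_add a
  rw [zero_mul, add_zero] at h2
  refine h2.congr' ?_
  filter_upwards [h, eventually_gt_atTop 0] with n hn hn0
  have : (n : ℂ) ≠ 0 := by exact_mod_cast hn0.ne'
  rw [hn]
  field_simp

/-- The second-order Taylor expansion along a sequence of increments of order `1 / √n`. -/
lemma tendsto_taylor_two {F m : ℂ → ℂ} {z₀ s ζ : ℂ} (hF : ∀ᶠ z in 𝓝 z₀, HasDerivAt F (m z) z)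
    (hm : HasDerivAt m s z₀) {δ : ℕ → ℂ} (hδ : Tendsto δ atTop (𝓝 0))
    (hζ : Tendsto (fun n : ℕ => n * δ n ^ 2) atTop (𝓝 ζ)) :
    Tendsto (fun n : ℕ => n * (F (z₀ + δ n) - F z₀ - m z₀ * δ n)) atTop (𝓝 (s / 2 * ζ)) := by
  -- The Taylor remainder. Its derivative is `o(|z - z₀|)`, and the mean value inequality on the
  -- disc of radius `|z - z₀|` makes it `o(|z - z₀|²)`.
  set f : ℂ → ℂ := fun z => F z - F z₀ - m z₀ * (z - z₀) - s / 2 * (z - z₀) ^ 2 with hf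
  have hfd : ∀ᶠ z in 𝓝 z₀, HasDerivAt f (m z - m z₀ - (z - z₀) * s) z := by
    filter_upwards [hF] with z hz
    have h1 : HasDerivAt (fun z => z - z₀) 1 z := (hasDerivAt_id z).sub_const z₀
    refine (((hz.sub_const (F z₀)).sub (h1.const_mul (m z₀))).sub
      ((h1.pow 2).const_mul (s / 2))).congr_deriv ?_
    simp
    ring
  have ho : (fun z => f z) =o[𝓝 z₀] fun z => (z - z₀) ^ 2 := by
    rw [Asymptotics.isLittleO_iff]
    intro c hc
    have hb := (Asymptotics.isLittleO_iff.1 hm.isLittleO) hc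
    obtain ⟨r, hr, hball⟩ := Metric.eventually_nhds_iff_ball.1 (hfd.and hb)
    filter_upwards [Metric.ball_mem_nhds z₀ hr] with z hz
    have hsub : Metric.closedBall z₀ (dist z z₀) ⊆ Metric.ball z₀ r :=
      Metric.closedBall_subset_ball hz
    have := (convex_closedBall z₀ (dist z z₀)).norm_image_sub_le_of_norm_hasDerivWithin_le
      (f := f) (C := c * ‖z - z₀‖)
      (fun x hx => (hball x (hsub hx)).1.hasDerivWithinAt)
      (fun x hx => by
        have h1 := (hball x (hsub hx)).2
        rw [smul_eq_mul] at h1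
        refine h1.trans ?_
        rw [← dist_eq_norm, ← dist_eq_norm]
        gcongr
        exact hx)
      (Metric.mem_closedBall_self dist_nonneg) (y := z) (by simp)
    have hf0 : f z₀ = 0 := by simp [hf]
    rw [hf0, sub_zero] at this
    rw [norm_pow]
    linarith
  have hz : Tendsto (fun n => z₀ + δ n) atTop (𝓝 z₀) := by simpa using hδ.const_add z₀
  have ho2 := ho.comp_tendsto hz
  have h3 : Tendsto (fun n : ℕ => (n : ℂ) * f (z₀ + δ n)) atTop (𝓝 0) := by
    have h4 : (fun n : ℕ => (n : ℂ) * f (z₀ + δ n)) =o[atTop] fun n : ℕ => (n : ℂ) * δ n ^ 2 := by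
      refine (Asymptotics.isBigO_refl _ _).mul_isLittleO ?_
      simpa [Function.comp_def] using ho2
    exact (Asymptotics.isLittleO_one_iff ℂ).1 (h4.trans_isBigO (hζ.isBigO_one ℂ))
  have h5 := h3.add (hζ.const_mul (s / 2))
  rw [zero_add] at h5
  refine h5.congr fun n => ?_
  simp only [hf]
  ring

/-- The central limit theorem in transform form. The quotient of the values of `Z n / lam ^ n` at
`z₀ + δ n` and `z₀` tends to `1` by local uniformity; the quotient of the powers of `lam` is `exp (n
F)`, to be expanded to second order. -/
lemma IsQuasiPower.tendsto_ratio {Z : ℕ → ℂ → ℂ} {lam m s : ℂ → ℂ} {z₀ : ℂ}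
    (H : IsQuasiPower Z lam m s z₀) (hZ : ∀ n, Differentiable ℂ (Z n)) {δ : ℕ → ℂ} {ζ : ℂ}
    (hδ : Tendsto δ atTop (𝓝 0)) (hζ : Tendsto (fun n : ℕ => n * δ n ^ 2) atTop (𝓝 ζ)) :
    Tendsto (fun n : ℕ => Z n (z₀ + δ n) / Z n z₀ * Complex.exp (-(n * m z₀ * δ n))) atTop
      (𝓝 (Complex.exp (s z₀ / 2 * ζ))) := by
  obtain ⟨U, hU, hz₀, hd, A, hA, hA0⟩ := H
  have hUn : U ∈ 𝓝 z₀ := hU.mem_nhds hz₀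
  have hl0 := (hd z₀ hz₀).1
  have hz : Tendsto (fun n => z₀ + δ n) atTop (𝓝 z₀) := by simpa using hδ.const_add z₀
  have hGd (n : ℕ) : DifferentiableOn ℂ (fun z => Z n z / lam z ^ n) U := fun z hz =>
    ((hZ n z).div ((hd z hz).2.1.differentiableAt.pow n)
      (pow_ne_zero _ (hd z hz).1)).differentiableWithinAt
  have hAd := hA.differentiableOn (Eventually.of_forall hGd) hU
  have t0 := hA.tendsto_at hz₀
  have t1 : Tendsto (fun n => Z n (z₀ + δ n) / lam (z₀ + δ n) ^ n) atTop (𝓝 (A z₀)) := by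
    refine hA.tendsto_comp (hAd z₀ hz₀).continuousWithinAt hz₀ ?_
    exact tendsto_nhdsWithin_iff.2 ⟨hz, hz.eventually hUn⟩
  have t2 := t1.div t0 hA0
  rw [div_self hA0] at t2
  -- Dividing by `lam z₀` keeps the argument near `1`, away from the cut of the logarithm.
  set F : ℂ → ℂ := fun z => Complex.log (lam z / lam z₀) with hF
  have hFd : ∀ᶠ z in 𝓝 z₀, HasDerivAt F (m z) z := by
    have hc : ContinuousAt (fun z => lam z / lam z₀) z₀ :=
      (hd z₀ hz₀).2.1.continuousAt.div_const _
    have : ∀ᶠ z in 𝓝 z₀, lam z / lam z₀ ∈ Complex.slitPlane :=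
      hc.eventually_mem (Complex.isOpen_slitPlane.mem_nhds (by simp [hl0]))
    filter_upwards [this, hUn] with z hz hzU
    refine (((hd z hzU).2.1.div_const (lam z₀)).clog hz).congr_deriv ?_
    have := (hd z hzU).1
    field_simp
  have t3 := (tendsto_taylor_two hFd (hd z₀ hz₀).2.2 hδ hζ).cexp
  have t4 := t2.mul t3
  rw [one_mul] at t4
  refine t4.congr' ?_
  filter_upwards [hz.eventually hUn, t0.eventually_ne hA0] with n hn hZ0
  have hln := (hd _ hn).1
  have hZn : Z n z₀ ≠ 0 := fun h => hZ0 (by rw [h, zero_div])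
  have e : Complex.exp (n * (F (z₀ + δ n) - F z₀ - m z₀ * δ n))
      = (lam (z₀ + δ n) / lam z₀) ^ n * Complex.exp (-(n * m z₀ * δ n)) := by
    have hF0 : F z₀ = 0 := by simp [hF]
    have : (n : ℂ) * (F (z₀ + δ n) - F z₀ - m z₀ * δ n)
        = n * F (z₀ + δ n) + -(n * m z₀ * δ n) := by rw [hF0]; ring
    rw [this, Complex.exp_add, Complex.exp_nat_mul, hF, Complex.exp_log (div_ne_zero hln hl0)]
  rw [e, Pi.div_apply, div_pow]
  field_simp

/-! ### Moments as derivatives of the partition function -/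

/-- The holomorphic continuation of the Ising weight. -/
def complexWeight {n : ℕ} (A : Matrix (Fin n) (Fin n) ℝ) (β : ℝ) (z : ℂ) (x : Config n) : ℂ :=
  Complex.exp (((β * (x.vec ⬝ᵥ (A *ᵥ x.vec)) : ℝ) : ℂ) + z * ((∑ i, x.vec i : ℝ) : ℂ))

lemma complexWeight_ofReal {n : ℕ} (A : Matrix (Fin n) (Fin n) ℝ) (β h : ℝ) (x : Config n) :
    complexWeight A β h x = (isingWeight A β h x : ℝ) := by
  simp [complexWeight, isingWeight_eq]

lemma complexWeight_add {n : ℕ} (A : Matrix (Fin n) (Fin n) ℝ) (β : ℝ) (z t : ℂ) (x : Config n) :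
    complexWeight A β (z + t) x
      = complexWeight A β z x * Complex.exp (t * ((∑ i, x.vec i : ℝ) : ℂ)) := by
  rw [complexWeight, complexWeight, ← Complex.exp_add]
  ring_nf

lemma hasDerivAt_complexWeight {n : ℕ} (A : Matrix (Fin n) (Fin n) ℝ) (β : ℝ) (z : ℂ)
    (x : Config n) : HasDerivAt (fun z => complexWeight A β z x)
      (((∑ i, x.vec i : ℝ) : ℂ) * complexWeight A β z x) z := by
  refine ((((hasDerivAt_id z).mul_const ((∑ i, x.vec i : ℝ) : ℂ)).const_add
    ((β * (x.vec ⬝ᵥ (A *ᵥ x.vec)) : ℝ) : ℂ)).cexp).congr_deriv ?_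
  simp [complexWeight]
  ring

lemma hasDerivAt_sum_complexWeight {n : ℕ} (A : Matrix (Fin n) (Fin n) ℝ) (β : ℝ) (k : ℕ) (z : ℂ) :
    HasDerivAt (fun z => ∑ x : Config n, ((∑ i, x.vec i : ℝ) : ℂ) ^ k * complexWeight A β z x)
      (∑ x : Config n, ((∑ i, x.vec i : ℝ) : ℂ) ^ (k + 1) * complexWeight A β z x) z := by
  refine (HasDerivAt.fun_sum fun x _ =>
    (hasDerivAt_complexWeight A β z x).const_mul (((∑ i, x.vec i : ℝ) : ℂ) ^ k)).congr_deriv ?_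
  refine Finset.sum_congr rfl fun x _ => ?_
  ring

lemma hasDerivAt_complexPartition {n : ℕ} (A : Matrix (Fin n) (Fin n) ℝ) (β : ℝ) (z : ℂ) :
    HasDerivAt (complexPartition A β)
      (∑ x : Config n, ((∑ i, x.vec i : ℝ) : ℂ) ^ 1 * complexWeight A β z x) z := by
  have h := hasDerivAt_sum_complexWeight A β 0 z
  simp only [pow_zero, one_mul] at h
  exact h

lemma differentiable_complexPartition {n : ℕ} (A : Matrix (Fin n) (Fin n) ℝ) (β : ℝ) :
    Differentiable ℂ (complexPartition A β) :=
  fun z => (hasDerivAt_complexPartition A β z).differentiableAt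

lemma isingWeight_pos {n : ℕ} (A : Matrix (Fin n) (Fin n) ℝ) (β h : ℝ) (x : Config n) :
    0 < isingWeight A β h x := Real.exp_pos _

lemma partitionFunction_pos {n : ℕ} (A : Matrix (Fin n) (Fin n) ℝ) (β h : ℝ) :
    0 < partitionFunction A β h :=
  Finset.sum_pos (fun x _ => isingWeight_pos A β h x) Finset.univ_nonempty

lemma isingPrior_nonneg {n : ℕ} (A : Matrix (Fin n) (Fin n) ℝ) (β h : ℝ) (x : Config n) :
    0 ≤ isingPrior A β h x :=
  div_nonneg (isingWeight_pos A β h x).le (partitionFunction_pos A β h).le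

lemma sum_isingPrior {n : ℕ} (A : Matrix (Fin n) (Fin n) ℝ) (β h : ℝ) :
    ∑ x, isingPrior A β h x = 1 := by
  simp_rw [isingPrior, ← Finset.sum_div]
  exact div_self (partitionFunction_pos A β h).ne'

lemma avgMean_eq_div {n : ℕ} (A : Matrix (Fin n) (Fin n) ℝ) (β h : ℝ) :
    avgMean A β h = 1 / (n : ℝ) * ((∑ x : Config n, (∑ i, x.vec i) * isingWeight A β h x)
      / partitionFunction A β h) := by
  simp only [avgMean, isingPrior, Config.avg]
  rw [Finset.sum_div, Finset.mul_sum]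
  refine Finset.sum_congr rfl fun x _ => ?_
  ring

lemma avgVariance_eq {n : ℕ} (A : Matrix (Fin n) (Fin n) ℝ) (β h : ℝ) :
    avgVariance A β h = 1 / (n : ℝ) ^ 2 * ((∑ x : Config n, (∑ i, x.vec i) ^ 2
      * isingWeight A β h x) / partitionFunction A β h) - avgMean A β h ^ 2 := by
  have e : ∀ x : Config n, isingPrior A β h x * (x.avg - avgMean A β h) ^ 2
      = 1 / (n : ℝ) ^ 2 * ((∑ i, x.vec i) ^ 2 * isingWeight A β h x / partitionFunction A β h)
        - 2 * avgMean A β h * (isingPrior A β h x * x.avg)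
        + avgMean A β h ^ 2 * isingPrior A β h x := by
    intro x
    rw [isingPrior, Config.avg]
    ring
  rw [avgVariance]
  simp_rw [e]
  rw [Finset.sum_add_distrib, Finset.sum_sub_distrib, ← Finset.mul_sum, ← Finset.mul_sum,
    ← Finset.mul_sum, sum_isingPrior, ← avgMean, ← Finset.sum_div]
  ring

lemma avgMean_eq {n : ℕ} (A : Matrix (Fin n) (Fin n) ℝ) (β h : ℝ) :
    ((avgMean A β h : ℝ) : ℂ) = 1 / (n : ℂ) * logDeriv (complexPartition A β) h := by
  rw [logDeriv_apply, (hasDerivAt_complexPartition A β h).deriv, complexPartition_ofReal,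
    avgMean_eq_div]
  simp_rw [complexWeight_ofReal]
  push_cast
  simp_rw [pow_one]

/-- The derivative of `Z'/Z` is `Z''/Z - (Z'/Z)²`, the variance of the total sentiment, which is
`n²` times that of the average. -/
lemma mul_avgVariance_eq {n : ℕ} (hn : 0 < n) (A : Matrix (Fin n) (Fin n) ℝ) (β h : ℝ) :
    ((n * avgVariance A β h : ℝ) : ℂ)
      = 1 / (n : ℂ) * deriv (logDeriv (complexPartition A β)) h := by
  have hZ : complexPartition A β h ≠ 0 := by
    rw [complexPartition_ofReal]
    exact_mod_cast (partitionFunction_pos A β h).ne'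
  have hd : deriv (complexPartition A β)
      = fun z => ∑ x : Config n, ((∑ i, x.vec i : ℝ) : ℂ) ^ 1 * complexWeight A β z x :=
    funext fun z => (hasDerivAt_complexPartition A β z).deriv
  have h1 := (hasDerivAt_sum_complexWeight A β 1 h).div (hasDerivAt_complexPartition A β h) hZ
  rw [← hd] at h1
  rw [logDeriv, h1.deriv, complexPartition_ofReal]
  simp_rw [complexWeight_ofReal]
  have hZ0 := (partitionFunction_pos A β h).ne'
  have hn0 : (n : ℝ) ≠ 0 := by positivity
  have e : n * avgVariance A β h = 1 / (n : ℝ) * (((∑ x : Config n, (∑ i, x.vec i) ^ (1 + 1)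
      * isingWeight A β h x) * partitionFunction A β h
      - (∑ x : Config n, (∑ i, x.vec i) ^ 1 * isingWeight A β h x)
        * ∑ x : Config n, (∑ i, x.vec i) ^ 1 * isingWeight A β h x)
      / partitionFunction A β h ^ 2) := by
    rw [avgVariance_eq, avgMean_eq_div]
    simp_rw [pow_one]
    field_simp
  rw [e]
  push_cast
  rfl

lemma tendsto_freeEntropy_of_isQuasiPower {A : ∀ n, Matrix (Fin n) (Fin n) ℝ} {β h : ℝ}
    {lam m s : ℂ → ℂ} (H : IsQuasiPower (fun n => complexPartition (A n) β) lam m s h) :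
    Tendsto (fun n => freeEntropy (A n) β h) atTop (𝓝 (Real.log ‖lam h‖)) := by
  refine H.tendsto_log.congr fun n => ?_
  rw [freeEntropy, complexPartition_ofReal, Complex.norm_real, Real.norm_eq_abs,
    abs_of_pos (partitionFunction_pos _ _ _)]

lemma tendsto_avgMean_of_isQuasiPower {A : ∀ n, Matrix (Fin n) (Fin n) ℝ} {β h μ : ℝ}
    {lam m s : ℂ → ℂ} (H : IsQuasiPower (fun n => complexPartition (A n) β) lam m s h)
    (hμ : m h = μ) : Tendsto (fun n => avgMean (A n) β h) atTop (𝓝 μ) := by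
  obtain ⟨c, d, c₀, d₀, hc, hd, hev⟩ :=
    H.logDeriv_eq fun n => differentiable_complexPartition (A n) β
  have := tendsto_one_div_mul_of_eventually_eq hc (hev.mono fun n hn => hn.1)
  rw [hμ] at this
  exact tendsto_ofReal_iff.1 (this.congr fun n => (avgMean_eq _ _ _).symm)

lemma tendsto_avgVariance_of_isQuasiPower {A : ∀ n, Matrix (Fin n) (Fin n) ℝ} {β h v : ℝ}
    {lam m s : ℂ → ℂ} (H : IsQuasiPower (fun n => complexPartition (A n) β) lam m s h)
    (hv : s h = v) : Tendsto (fun n : ℕ => (n : ℝ) * avgVariance (A n) β h) atTop (𝓝 v) := by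
  obtain ⟨c, d, c₀, d₀, hc, hd, hev⟩ :=
    H.logDeriv_eq fun n => differentiable_complexPartition (A n) β
  have := tendsto_one_div_mul_of_eventually_eq hd (hev.mono fun n hn => hn.2)
  rw [hv] at this
  have h2 : Tendsto (fun n : ℕ => (((n : ℝ) * avgVariance (A n) β h : ℝ) : ℂ)) atTop (𝓝 v) := by
    refine this.congr' ?_
    filter_upwards [eventually_gt_atTop 0] with n hn
    exact (mul_avgVariance_eq hn _ _ _).symm
  exact tendsto_ofReal_iff.1 h2

/-- The partition functions of the three networks are quasi-powers at every real magnetic field. -/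
lemma Network.isQuasiPower (F : Network) {β : ℝ} (hβ : 0 < β) :
    ∃ lam m s : ℂ → ℂ, ∀ h : ℝ,
      IsQuasiPower (fun n => complexPartition (F.adjacency n) β) lam m s h ∧
      lam h = (Real.exp (F.psi (2 * β) h) : ℝ) ∧ m h = (F.mu (2 * β) h : ℝ) ∧
      s h = (F.sigmaSq (2 * β) h : ℝ) := by
  have key (h : ℝ) : eigenvalueMax (2 * β) h = (Real.exp (2 * β + Real.log (Real.cosh h
        + Real.sqrt (Real.sinh h ^ 2 + Real.exp (-4 * (2 * β))))) : ℝ) ∧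
      Complex.sinh h / discSqrt (2 * β) h
        = (Real.sinh h / Real.sqrt (Real.sinh h ^ 2 + Real.exp (-4 * (2 * β))) : ℝ) ∧
      Complex.exp (-4 * (2 * β : ℝ)) * Complex.cosh h / discSqrt (2 * β) h ^ 3
        = (Real.exp (-4 * (2 * β)) * Real.cosh h
            / (Real.sinh h ^ 2 + Real.exp (-4 * (2 * β))) ^ (3 / 2 : ℝ) : ℝ) := by
    have hd := disc_real_pos (2 * β) h
    have hc := Real.cosh_pos h
    refine ⟨?_, ?_, ?_⟩
    · rw [eigenvalueMax, discSqrt_ofReal, Real.exp_add, Real.exp_log (by positivity)]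
      push_cast
      ring
    · rw [discSqrt_ofReal]
      push_cast
      ring
    · have : (Real.sinh h ^ 2 + Real.exp (-4 * (2 * β))) ^ (3 / 2 : ℝ)
          = Real.sqrt (Real.sinh h ^ 2 + Real.exp (-4 * (2 * β))) ^ 3 := by
        rw [Real.sqrt_eq_rpow, ← Real.rpow_mul_natCast hd.le]
        norm_num
      rw [discSqrt_ofReal, this]
      push_cast
      ring
  cases F with
  | empty =>
    refine ⟨_, _, _, fun h => ⟨isQuasiPower_empty β h, ?_, ?_, ?_⟩⟩
    · have := Real.cosh_pos h
      rw [Network.psi, Real.exp_log (by positivity)]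
      push_cast
      ring
    · rw [Network.mu, Real.tanh_eq_sinh_div_cosh]
      push_cast
      ring
    · rw [Network.sigmaSq]
      push_cast
      ring
  | chain => exact ⟨_, _, _, fun h => ⟨isQuasiPower_chain hβ h, key h⟩⟩
  | ring => exact ⟨_, _, _, fun h => ⟨isQuasiPower_ring hβ h, key h⟩⟩

lemma Network.sigmaSq_pos (F : Network) (J h : ℝ) : 0 < F.sigmaSq J h := by
  have hc := Real.cosh_pos h
  have hd := disc_real_pos J h
  cases F <;> simp only [Network.sigmaSq] <;> positivity

lemma Network.tendsto_freeEntropy (F : Network) {β : ℝ} (hβ : 0 < β) (h : ℝ) :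
    Tendsto (fun n => freeEntropy (F.adjacency n) β h) atTop (𝓝 (F.psi (2 * β) h)) := by
  obtain ⟨lam, m, s, H⟩ := F.isQuasiPower hβ
  have := tendsto_freeEntropy_of_isQuasiPower (H h).1
  rwa [(H h).2.1, Complex.norm_real, Real.norm_eq_abs, Real.abs_exp, Real.log_exp] at this

/-- The complex derivative of `λ` restricts to the real axis. This needs `λ = exp ψ` at all real
fields, which is why `Network.isQuasiPower` chooses `lam, m, s` before `h`. -/
lemma Network.hasDerivAt_psi (F : Network) {β : ℝ} (hβ : 0 < β) (h : ℝ) :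
    HasDerivAt (fun t => F.psi (2 * β) t) (F.mu (2 * β) h) h := by
  obtain ⟨lam, m, s, H⟩ := F.isQuasiPower hβ
  obtain ⟨⟨U, -, hh, hd, -⟩, h1, h2, -⟩ := H h
  have h3 := ((hd h hh).2.1.real_of_complex).log (by rw [h1, Complex.ofReal_re]; positivity)
  refine (h3.congr_deriv ?_).congr_of_eventuallyEq (Eventually.of_forall fun t => ?_)
  · rw [h1, h2, ← Complex.ofReal_mul, Complex.ofReal_re, Complex.ofReal_re]
    field_simp
  · simp only
    rw [(H t).2.1, Complex.ofReal_re, Real.log_exp]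

lemma Network.hasDerivAt_mu (F : Network) {β : ℝ} (hβ : 0 < β) (h : ℝ) :
    HasDerivAt (fun t => F.mu (2 * β) t) (F.sigmaSq (2 * β) h) h := by
  obtain ⟨lam, m, s, H⟩ := F.isQuasiPower hβ
  obtain ⟨⟨U, -, hh, hd, -⟩, -, -, h1⟩ := H h
  have h3 := (hd h hh).2.2.real_of_complex
  refine (h3.congr_deriv ?_).congr_of_eventuallyEq (Eventually.of_forall fun t => ?_)
  · rw [h1, Complex.ofReal_re]
  · simp only
    rw [(H t).2.2.1, Complex.ofReal_re]

/-! ### The channel and exponential decay off the critical threshold -/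

lemma channel_nonneg {n : ℕ} {p : ℝ} (hp : 0 ≤ p) (hp' : p ≤ 1) (x y : Config n) :
    0 ≤ channel p x y := by
  refine Finset.prod_nonneg fun i _ => ?_
  split_ifs <;> linarith

/-- The expectation, given the sentiments, of a product over the members. -/
lemma sum_channel_mul_prod {n : ℕ} (p : ℝ) (x : Config n) (f : ℤˣ → ℂ) :
    ∑ y : Config n, (channel p x y : ℂ) * ∏ i, f (y i)
      = ∏ i, ((1 - p) * f (x i) + p * f (-x i)) := by
  simp_rw [channel, Complex.ofReal_prod, ← Finset.prod_mul_distrib]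
  rw [sum_prod_config fun i a => ((if a = x i then 1 - p else p : ℝ) : ℂ) * f a]
  refine Finset.prod_congr rfl fun i _ => ?_
  rcases Int.units_eq_one_or (x i) with h | h
  · simp [h, show (-1 : ℤˣ) ≠ 1 by decide]
  · simp [h, show (1 : ℤˣ) ≠ -1 by decide, add_comm]

lemma sum_channel {n : ℕ} (p : ℝ) (x : Config n) : ∑ y : Config n, channel p x y = 1 := by
  have := sum_channel_mul_prod p x fun _ => 1
  simp only [Finset.prod_const_one, mul_one, sub_add_cancel] at this
  exact_mod_cast this

/-- If the two possible conditional means are `exp (l ± s)`, then the conditional expectation of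
`exp (t ∑ y_i)` is `exp (n l + s ∑ x_i)`. -/
lemma sum_channel_mul_exp {n : ℕ} {p : ℝ} {t l s : ℂ}
    (h1 : (1 - p) * Complex.exp t + p * Complex.exp (-t) = Complex.exp (l + s))
    (h2 : (1 - p) * Complex.exp (-t) + p * Complex.exp t = Complex.exp (l - s)) (x : Config n) :
    ∑ y : Config n, (channel p x y : ℂ) * Complex.exp (t * ((∑ i, y.vec i : ℝ) : ℂ))
      = Complex.exp (n * l + s * ((∑ i, x.vec i : ℝ) : ℂ)) := by
  have := sum_channel_mul_prod p x fun a => Complex.exp (t * ((a : ℤ) : ℂ))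
  simp_rw [← Complex.exp_sum, ← Finset.mul_sum] at this
  simp only [Config.vec, Complex.ofReal_sum, Complex.ofReal_intCast]
  rw [this]
  have h3 : ∀ i, (1 - p) * Complex.exp (t * ((x i : ℤ) : ℂ)) + p * Complex.exp (t * ((-x i : ℤˣ) : ℤ))
      = Complex.exp (l + s * ((x i : ℤ) : ℂ)) := by
    intro i
    rcases Int.units_eq_one_or (x i) with h | h
    · simpa [h] using h1
    · simpa [h, sub_eq_add_neg] using h2
  simp_rw [h3, ← Complex.exp_sum, Finset.sum_add_distrib, ← Finset.mul_sum]
  simp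

/-- The complex moment generating function of the total sentiment. -/
lemma sum_isingPrior_mul_exp {n : ℕ} (A : Matrix (Fin n) (Fin n) ℝ) (β h : ℝ) (t : ℂ) :
    ∑ x : Config n, (isingPrior A β h x : ℂ) * Complex.exp (t * ((∑ i, x.vec i : ℝ) : ℂ))
      = complexPartition A β (h + t) / complexPartition A β h := by
  have : complexPartition A β (h + t) = ∑ x : Config n, complexWeight A β (h + t) x := rfl
  rw [this, complexPartition_ofReal, Finset.sum_div]
  refine Finset.sum_congr rfl fun x _ => ?_
  rw [complexWeight_add, complexWeight_ofReal, isingPrior]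
  push_cast
  ring

lemma partitionFunction_eq_exp {n : ℕ} (hn : 0 < n) (A : Matrix (Fin n) (Fin n) ℝ) (β h : ℝ) :
    partitionFunction A β h = Real.exp (n * freeEntropy A β h) := by
  have : (n : ℝ) ≠ 0 := by positivity
  rw [freeEntropy, ← mul_assoc, mul_one_div_cancel this, one_mul,
    Real.exp_log (partitionFunction_pos A β h)]

lemma sum_isingPrior_mul_exp_real {n : ℕ} (hn : 0 < n) (A : Matrix (Fin n) (Fin n) ℝ)
    (β h t : ℝ) : ∑ x : Config n, isingPrior A β h x * Real.exp (t * ∑ i, x.vec i)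
      = Real.exp (n * (freeEntropy A β (h + t) - freeEntropy A β h)) := by
  have := sum_isingPrior_mul_exp A β h t
  rw [← Complex.ofReal_add, complexPartition_ofReal, complexPartition_ofReal] at this
  rw [mul_sub, Real.exp_sub, ← partitionFunction_eq_exp hn, ← partitionFunction_eq_exp hn]
  exact_mod_cast this

/-- The pointwise inequality behind Chernoff's bound; the sign of `t` selects the upper or the lower
tail. -/
lemma one_le_exp_of_avg {n : ℕ} (hn : 0 < n) {t a : ℝ} {x : Config n} (h : 0 ≤ t * (x.avg - a)) :
    1 ≤ Real.exp (-(n * (t * a))) * Real.exp (t * ∑ i, x.vec i) := by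
  have hn0 : (0 : ℝ) < n := by exact_mod_cast hn
  rw [← Real.exp_add, Real.one_le_exp_iff]
  have : -(n * (t * a)) + t * ∑ i, x.vec i = n * (t * (x.avg - a)) := by
    rw [Config.avg]
    field_simp
    ring
  rw [this]
  positivity

/-- Chernoff bound for the average sentiment. -/
lemma prior_tail_le {n : ℕ} (hn : 0 < n) (A : Matrix (Fin n) (Fin n) ℝ) (β h t S : ℝ) :
    ∑ x : Config n, (if 0 ≤ t * (x.avg - S) then isingPrior A β h x else 0)
      ≤ Real.exp (n * (freeEntropy A β (h + t) - freeEntropy A β h - t * S)) := by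
  calc _ ≤ ∑ x : Config n, Real.exp (-(n * (t * S)))
        * (isingPrior A β h x * Real.exp (t * ∑ i, x.vec i)) := by
        refine Finset.sum_le_sum fun x _ => ?_
        have h0 := isingPrior_nonneg A β h x
        split_ifs with hx
        · nlinarith [one_le_exp_of_avg hn hx]
        · positivity
    _ = _ := by
        rw [← Finset.mul_sum, sum_isingPrior_mul_exp_real hn, ← Real.exp_add]
        ring_nf

/-- Chernoff bound for the average measurement. -/
lemma measurement_tail_le {n : ℕ} (hn : 0 < n) (A : Matrix (Fin n) (Fin n) ℝ) (β h a : ℝ)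
    {p t l s : ℝ} (hp : 0 ≤ p) (hp' : p ≤ 1)
    (h1 : (1 - p) * Real.exp t + p * Real.exp (-t) = Real.exp (l + s))
    (h2 : (1 - p) * Real.exp (-t) + p * Real.exp t = Real.exp (l - s)) :
    ∑ x : Config n, ∑ y : Config n,
      (if 0 ≤ t * (y.avg - a) then isingPrior A β h x * channel p x y else 0)
      ≤ Real.exp (n * (l + (freeEntropy A β (h + s) - freeEntropy A β h) - t * a)) := by
  have hc (x : Config n) : ∑ y : Config n, channel p x y * Real.exp (t * ∑ i, y.vec i)
      = Real.exp (n * l + s * ∑ i, x.vec i) := by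
    have := sum_channel_mul_exp (p := p) (t := t) (l := l) (s := s) (by exact_mod_cast h1)
      (by exact_mod_cast h2) x
    exact_mod_cast this
  calc _ ≤ ∑ x : Config n, ∑ y : Config n, Real.exp (-(n * (t * a)))
        * (isingPrior A β h x * (channel p x y * Real.exp (t * ∑ i, y.vec i))) := by
        refine Finset.sum_le_sum fun x _ => Finset.sum_le_sum fun y _ => ?_
        have h0 := mul_nonneg (isingPrior_nonneg A β h x) (channel_nonneg hp hp' x y)
        split_ifs with hy
        · nlinarith [one_le_exp_of_avg hn hy]
        · have h3 := isingPrior_nonneg A β h x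
          have h4 := channel_nonneg hp hp' x y
          positivity
    _ = _ := by
        simp_rw [← Finset.mul_sum, hc, Real.exp_add]
        have : ∀ x : Config n, isingPrior A β h x * (Real.exp (n * l)
            * Real.exp (s * ∑ i, x.vec i))
            = Real.exp (n * l) * (isingPrior A β h x * Real.exp (s * ∑ i, x.vec i)) :=
          fun x => by ring
        simp_rw [this, ← Finset.mul_sum]
        rw [sum_isingPrior_mul_exp_real hn, ← Real.exp_add, ← Real.exp_add]
        ring_nf

/-- A small step against the slope makes `K` negative. This supplies Chernoff parameters with
negative exponent and known sign. -/
lemma exists_neg_of_hasDerivAt {K : ℝ → ℝ} {k : ℝ} (hK : HasDerivAt K k 0) (hK0 : K 0 = 0)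
    (hk : k ≠ 0) : ∃ t, K t < 0 ∧ t * k < 0 := by
  have h1 : HasDerivAt (fun u => K (-k * u)) (k * (-k)) 0 := by
    refine HasDerivAt.comp (h₂ := K) (h := fun u => -k * u) 0 (by simpa using hK) ?_
    simpa using (hasDerivAt_id (0 : ℝ)).const_mul (-k)
  have h2 := h1.tendsto_slope_zero_right
  have hk2 : 0 < k * k := mul_self_pos.2 hk
  obtain ⟨u, hu, hu0⟩ := ((h2.eventually_lt_const (u := 0) (by linarith)).and
    self_mem_nhdsWithin).exists
  have hu0 : 0 < u := hu0
  simp only [zero_add, mul_zero, hK0, sub_zero, smul_eq_mul] at hu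
  refine ⟨-k * u, ?_, by nlinarith⟩
  by_contra! hc
  have := mul_nonneg (inv_pos.2 hu0).le hc
  linarith

lemma errorProb_nonneg {n : ℕ} (A : Matrix (Fin n) (Fin n) ℝ) (β h S : ℝ) {p : ℝ} (hp : 0 ≤ p)
    (hp' : p ≤ 1) : 0 ≤ errorProb A β h p S := by
  refine Finset.sum_nonneg fun x _ => Finset.sum_nonneg fun y _ => ?_
  split_ifs
  · exact mul_nonneg (isingPrior_nonneg A β h x) (channel_nonneg hp hp' x y)
  · exact le_rfl

/-- Outside both events the two deviations are nonzero and have the common sign opposite to that of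
`t₁` and `t₂`, so the detector is right. -/
lemma errorProb_le {n : ℕ} (A : Matrix (Fin n) (Fin n) ℝ) (β h S : ℝ) {p t₁ t₂ : ℝ} (hp : 0 ≤ p)
    (hp' : p ≤ 1) (ht : 0 < t₁ * t₂) :
    errorProb A β h p S
      ≤ ∑ x : Config n, (if 0 ≤ t₁ * (x.avg - S) then isingPrior A β h x else 0)
        + ∑ x : Config n, ∑ y : Config n, (if 0 ≤ t₂ * (y.avg - (1 - 2 * p) * S) then
            isingPrior A β h x * channel p x y else 0) := by
  have h1 : ∀ x : Config n, (if 0 ≤ t₁ * (x.avg - S) then isingPrior A β h x else 0)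
      = ∑ y : Config n,
        (if 0 ≤ t₁ * (x.avg - S) then isingPrior A β h x * channel p x y else 0) := by
    intro x
    split_ifs
    · rw [← Finset.mul_sum, sum_channel, mul_one]
    · simp
  simp_rw [h1, ← Finset.sum_add_distrib]
  refine Finset.sum_le_sum fun x _ => Finset.sum_le_sum fun y _ => ?_
  have h0 := mul_nonneg (isingPrior_nonneg A β h x) (channel_nonneg hp hp' x y)
  by_cases hx : 0 ≤ t₁ * (x.avg - S)
  · rw [if_pos hx]
    split_ifs <;> linarith
  by_cases hy : 0 ≤ t₂ * (y.avg - (1 - 2 * p) * S)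
  · rw [if_pos hy]
    split_ifs <;> linarith
  rw [if_neg hx, if_neg hy, if_neg]
  · simp
  push Not at hx hy ⊢
  rw [supermajority, detector]
  rcases pos_and_pos_or_neg_and_neg_of_mul_pos ht with ⟨h3, h4⟩ | ⟨h3, h4⟩
  · rw [sign_neg (neg_of_mul_neg_right hx h3.le), sign_neg (neg_of_mul_neg_right hy h4.le)]
  · rw [sign_pos (pos_of_mul_neg_right hx h3.le), sign_pos (pos_of_mul_neg_right hy h4.le)]

/-- Away from the limiting mean, the error probability decays exponentially. -/
lemma Network.errorProb_le_exp (F : Network) {β h p S : ℝ} (hβ : 0 < β) (hp : 0 ≤ p)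
    (hp' : p < 1 / 2) (hS : S ≠ F.mu (2 * β) h) :
    ∃ ε > 0, ∀ᶠ n : ℕ in atTop, errorProb (F.adjacency n) β h p S ≤ 2 * Real.exp (-(n * ε)) := by
  set μ := F.mu (2 * β) h with hμ
  set ψ := fun t => F.psi (2 * β) t with hψ
  have hψd : HasDerivAt ψ μ h := F.hasDerivAt_psi hβ h
  have hk : μ - S ≠ 0 := sub_ne_zero.2 hS.symm
  have hq : 0 < 1 - 2 * p := by linarith
  -- `P` and `Q` are the moment generating functions of a measurement of the sentiments `1` and
  -- `-1`. Below, `l` and `s` solve `P = e^{l+s}`, `Q = e^{l-s}`.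
  set P := fun t : ℝ => (1 - p) * Real.exp t + p * Real.exp (-t) with hP
  set Q := fun t : ℝ => (1 - p) * Real.exp (-t) + p * Real.exp t with hQ
  have hP0 (t : ℝ) : 0 < P t := by
    have := Real.exp_pos t
    have := Real.exp_pos (-t)
    have : 0 < 1 - p := by linarith
    positivity
  have hQ0 (t : ℝ) : 0 < Q t := by
    have := Real.exp_pos t
    have := Real.exp_pos (-t)
    have : 0 < 1 - p := by linarith
    positivity
  have hen : HasDerivAt (fun t : ℝ => Real.exp (-t)) (-1) 0 := by
    simpa using (hasDerivAt_neg (0 : ℝ)).exp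
  have hep : HasDerivAt Real.exp 1 0 := by simpa using Real.hasDerivAt_exp 0
  have hPd : HasDerivAt P (1 - 2 * p) 0 :=
    ((hep.const_mul (1 - p)).add (hen.const_mul p)).congr_deriv (by ring)
  have hQd : HasDerivAt Q (-(1 - 2 * p)) 0 :=
    ((hen.const_mul (1 - p)).add (hep.const_mul p)).congr_deriv (by ring)
  have hP1 : P 0 = 1 := by simp [hP]
  have hQ1 : Q 0 = 1 := by simp [hQ]
  set l := fun t : ℝ => 1 / 2 * (Real.log (P t) + Real.log (Q t)) with hl
  set s := fun t : ℝ => 1 / 2 * (Real.log (P t) - Real.log (Q t)) with hs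
  have hld : HasDerivAt l 0 0 :=
    (((hPd.log (hP0 0).ne').add (hQd.log (hQ0 0).ne')).const_mul (1 / 2)).congr_deriv
      (by rw [hP1, hQ1]; ring)
  have hsd : HasDerivAt s (1 - 2 * p) 0 :=
    (((hPd.log (hP0 0).ne').sub (hQd.log (hQ0 0).ne')).const_mul (1 / 2)).congr_deriv
      (by rw [hP1, hQ1]; ring)
  have hl0 : l 0 = 0 := by simp [hl, hP1, hQ1]
  have hs0 : s 0 = 0 := by simp [hs, hP1, hQ1]
  -- The limiting Chernoff exponents for `X̄` and `Ȳ`. Their slopes at `0` have the same sign since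
  -- `1 - 2p > 0`, so `t₁` and `t₂` will too.
  have hK1 : HasDerivAt (fun t => ψ (h + t) - ψ h - t * S) (μ - S) 0 := by
    have h1 : HasDerivAt (fun t => ψ (h + t)) μ 0 :=
      HasDerivAt.comp_const_add h 0 (by simpa using hψd)
    exact ((h1.sub_const (ψ h)).sub ((hasDerivAt_id (0 : ℝ)).mul_const S)).congr_deriv (by ring)
  have hK2 : HasDerivAt (fun t => l t + (ψ (h + s t) - ψ h) - t * ((1 - 2 * p) * S))
      ((1 - 2 * p) * (μ - S)) 0 := by
    have h1 : HasDerivAt (fun t => ψ (h + s t)) (μ * (1 - 2 * p)) 0 :=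
      HasDerivAt.comp (h₂ := ψ) (h := fun t => h + s t) 0 (by simpa [hs0] using hψd)
        (hsd.const_add h)
    exact ((hld.add (h1.sub_const (ψ h))).sub
      ((hasDerivAt_id (0 : ℝ)).mul_const ((1 - 2 * p) * S))).congr_deriv (by ring)
  obtain ⟨t₁, hn1, ht1⟩ := exists_neg_of_hasDerivAt hK1 (by simp) hk
  obtain ⟨t₂, hn2, ht2⟩ := exists_neg_of_hasDerivAt hK2 (by simp [hl0, hs0])
    (mul_ne_zero hq.ne' hk)
  have ht : 0 < t₁ * t₂ := by
    have h3 : 0 < (t₁ * t₂) * ((1 - 2 * p) * ((μ - S) * (μ - S))) := by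
      nlinarith [mul_pos_of_neg_of_neg ht1 ht2]
    exact pos_of_mul_pos_left h3 (mul_nonneg hq.le (mul_self_nonneg _))
  have hlim (t : ℝ) := F.tendsto_freeEntropy hβ t
  have l1 := (((hlim (h + t₁)).sub (hlim h)).sub_const (t₁ * S))
  have l2 := ((((hlim (h + s t₂)).sub (hlim h)).const_add (l t₂)).sub_const
    (t₂ * ((1 - 2 * p) * S)))
  -- A rate strictly below both limiting ones leaves room for the error in the free entropy at
  -- finite `n`.
  obtain ⟨ε, hε, hε'⟩ := exists_between (lt_min (neg_pos.2 hn1) (neg_pos.2 hn2))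
  refine ⟨ε, hε, ?_⟩
  have g1 := l1.eventually_lt_const (u := -ε) (by linarith [(lt_min_iff.1 hε').1])
  have g2 := l2.eventually_lt_const (u := -ε) (by linarith [(lt_min_iff.1 hε').2])
  filter_upwards [g1, g2, eventually_gt_atTop 0] with n g1 g2 hn
  have b1 := prior_tail_le hn (F.adjacency n) β h t₁ S
  have b2 := measurement_tail_le hn (F.adjacency n) β h ((1 - 2 * p) * S) (p := p) (t := t₂)
    (l := l t₂) (s := s t₂) hp (by linarith)
    (by
      have : l t₂ + s t₂ = Real.log (P t₂) := by simp only [hl, hs]; ring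
      rw [this, Real.exp_log (hP0 t₂)])
    (by
      have : l t₂ - s t₂ = Real.log (Q t₂) := by simp only [hl, hs]; ring
      rw [this, Real.exp_log (hQ0 t₂)])
  have hn0 : (0 : ℝ) < n := by exact_mod_cast hn
  have e1 : Real.exp (n * (freeEntropy (F.adjacency n) β (h + t₁)
      - freeEntropy (F.adjacency n) β h - t₁ * S)) ≤ Real.exp (-(n * ε)) :=
    Real.exp_le_exp.2 (by nlinarith)
  have e2 : Real.exp (n * (l t₂ + (freeEntropy (F.adjacency n) β (h + s t₂)
      - freeEntropy (F.adjacency n) β h) - t₂ * ((1 - 2 * p) * S))) ≤ Real.exp (-(n * ε)) :=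
    Real.exp_le_exp.2 (by nlinarith)
  have := errorProb_le (F.adjacency n) β h S hp (by linarith) ht
  linarith

lemma tendsto_zero_of_le_exp {f : ℕ → ℝ} (h0 : ∀ n, 0 ≤ f n) {ε : ℝ} (hε : 0 < ε)
    (h : ∀ᶠ n : ℕ in atTop, f n ≤ 2 * Real.exp (-(n * ε))) : Tendsto f atTop (𝓝 0) := by
  have h1 : Tendsto (fun n : ℕ => 2 * Real.exp (-(n * ε))) atTop (𝓝 (2 * 0)) := by
    refine Tendsto.const_mul 2 (Real.tendsto_exp_neg_atTop_nhds_zero.comp ?_)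
    exact tendsto_natCast_atTop_atTop.atTop_mul_const hε
  rw [mul_zero] at h1
  exact squeeze_zero' (Eventually.of_forall h0) h h1

lemma limsup_log_lt_zero_of_le_exp {f : ℕ → ℝ} {ε : ℝ} (hε : 0 < ε)
    (h : ∀ᶠ n : ℕ in atTop, f n ≤ 2 * Real.exp (-(n * ε))) :
    limsup (fun n : ℕ => ((1 / (n : ℝ) : ℝ) : EReal) * ENNReal.log (ENNReal.ofReal (f n))) atTop
      < 0 := by
  have h1 : Tendsto (fun n : ℕ => 1 / (n : ℝ) * Real.log 2 - ε) atTop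
      (𝓝 (0 * Real.log 2 - ε)) :=
    (tendsto_one_div_atTop_nhds_zero_nat.mul_const _).sub_const _
  have h2 := h1.eventually_lt_const (u := -(ε / 2)) (by linarith)
  refine lt_of_le_of_lt (b := ((-(ε / 2) : ℝ) : EReal)) ?_ (by exact_mod_cast (by linarith))
  refine limsup_le_of_le (by isBoundedDefault) ?_
  filter_upwards [h, h2, eventually_gt_atTop 0] with n hn hn2 hn0
  have hn0' : (0 : ℝ) < n := by exact_mod_cast hn0
  have h3 : ENNReal.log (ENNReal.ofReal (f n))
      ≤ ((Real.log 2 - n * ε : ℝ) : EReal) := by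
    have h4 : Real.log (2 * Real.exp (-(n * ε))) = Real.log 2 - n * ε := by
      rw [Real.log_mul (by norm_num) (Real.exp_ne_zero _), Real.log_exp]
      ring
    rw [← h4, ← ENNReal.log_ofReal_of_pos (by positivity)]
    exact ENNReal.log_le_log (ENNReal.ofReal_le_ofReal hn)
  refine (mul_le_mul_of_nonneg_left h3 (by exact_mod_cast (by positivity))).trans ?_
  rw [← EReal.coe_mul, EReal.coe_le_coe_iff]
  have : 1 / (n : ℝ) * (Real.log 2 - n * ε) = 1 / (n : ℝ) * Real.log 2 - ε := by
    field_simp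
  linarith

/-! ### Discrete laws and the Gaussian mass of a wedge -/

open MeasureTheory ProbabilityTheory

/-- The law on `E` that gives the point `g i` the mass `w i`. -/
def discreteLaw {ι E : Type*} [Fintype ι] [MeasurableSpace E] (w : ι → ℝ) (g : ι → E) : Measure E :=
  ∑ i, ENNReal.ofReal (w i) • Measure.dirac (g i)

lemma discreteLaw_apply {ι E : Type*} [Fintype ι] [MeasurableSpace E] {w : ι → ℝ}
    (hw : ∀ i, 0 ≤ w i) (g : ι → E) {s : Set E} [DecidablePred (· ∈ s)] (hs : MeasurableSet s) :
    discreteLaw w g s = ENNReal.ofReal (∑ i, if g i ∈ s then w i else 0) := by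
  rw [discreteLaw, Measure.finsetSum_apply, ENNReal.ofReal_sum_of_nonneg]
  · refine Finset.sum_congr rfl fun i _ => ?_
    rw [Measure.smul_apply, Measure.dirac_apply' _ hs, smul_eq_mul]
    by_cases h : g i ∈ s <;> simp [h]
  · intro i _
    split_ifs
    exacts [hw i, le_rfl]

lemma isProbabilityMeasure_discreteLaw {ι E : Type*} [Fintype ι] [MeasurableSpace E] {w : ι → ℝ}
    (hw : ∀ i, 0 ≤ w i) (hw1 : ∑ i, w i = 1) (g : ι → E) :
    IsProbabilityMeasure (discreteLaw w g) := by
  classical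
  refine ⟨?_⟩
  rw [discreteLaw_apply hw g MeasurableSet.univ]
  simp [hw1]

lemma charFun_discreteLaw {ι E : Type*} [Fintype ι] [MeasurableSpace E] [NormedAddCommGroup E]
    [InnerProductSpace ℝ E] [BorelSpace E] {w : ι → ℝ} (hw : ∀ i, 0 ≤ w i) (g : ι → E) (t : E) :
    charFun (discreteLaw w g) t = ∑ i, (w i : ℂ) * Complex.exp ((inner ℝ (g i) t : ℝ) * Complex.I) := by
  have hm : Measurable fun x : E => Complex.exp ((inner ℝ x t : ℝ) * Complex.I) := by
    have : Continuous fun x : E => Complex.exp ((inner ℝ x t : ℝ) * Complex.I) := by fun_prop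
    exact this.measurable
  rw [charFun_apply, discreteLaw, integral_finsetSum_measure]
  · refine Finset.sum_congr rfl fun i _ => ?_
    rw [integral_smul_measure, integral_dirac' _ _ hm.stronglyMeasurable,
      ENNReal.toReal_ofReal (hw i), Complex.real_smul]
  · intro i _
    refine Integrable.smul_measure ?_ ENNReal.ofReal_ne_top
    refine ⟨hm.aestronglyMeasurable, ?_⟩
    rw [hasFiniteIntegral_iff_enorm, lintegral_dirac' _ hm.enorm]
    exact enorm_lt_top

/-- The standard Gaussian law on the plane. -/
def planeGaussian : Measure (ℝ × ℝ) := (gaussianReal 0 1).prod (gaussianReal 0 1)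

instance : IsProbabilityMeasure planeGaussian := by
  unfold planeGaussian
  infer_instance

lemma planeGaussian_null (c : ℝ) : planeGaussian {z | z.1 * (c * z.1 + z.2) = 0} = 0 := by
  have hm : MeasurableSet {z : ℝ × ℝ | z.1 * (c * z.1 + z.2) = 0} :=
    measurableSet_eq_fun (by fun_prop) (by fun_prop)
  have := nullSingletonClass_gaussianReal (μ := 0) (v := 1) one_ne_zero
  rw [planeGaussian, Measure.measure_prod_null hm]
  have h0 : ∀ᵐ u ∂(gaussianReal 0 1), u ≠ 0 := by
    rw [ae_iff]
    simp
  filter_upwards [h0] with u hu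
  refine measure_mono_null (t := {-(c * u)}) ?_ (by simp)
  intro v hv
  have hv : u * (c * u + v) = 0 := hv
  have := (mul_eq_zero.1 hv).resolve_left hu
  rw [Set.mem_singleton_iff]
  linarith

/-- The standard Gaussian mass of a cone is proportional to its angular measure. -/
lemma planeGaussian_cone {s : Set (ℝ × ℝ)} (hs : MeasurableSet s)
    (hcone : ∀ r > 0, ∀ z : ℝ × ℝ, (r * z.1, r * z.2) ∈ s ↔ z ∈ s) :
    planeGaussian s * volume (Set.Ioo (-Real.pi) Real.pi)
      = volume (Set.Ioo (-Real.pi) Real.pi ∩ {θ | (Real.cos θ, Real.sin θ) ∈ s}) := by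
  set R : ENNReal := ∫⁻ r in Set.Ioi (0 : ℝ), ENNReal.ofReal r
    * ENNReal.ofReal ((Real.sqrt (2 * Real.pi))⁻¹ ^ 2 * Real.exp (-r ^ 2 / 2)) with hR
  have key : ∀ s : Set (ℝ × ℝ), MeasurableSet s →
      (∀ r > 0, ∀ z : ℝ × ℝ, (r * z.1, r * z.2) ∈ s ↔ z ∈ s) →
      planeGaussian s
        = R * volume (Set.Ioo (-Real.pi) Real.pi ∩ {θ | (Real.cos θ, Real.sin θ) ∈ s}) := by
    intro s hs hcone
    have hdens : planeGaussian = (volume : Measure (ℝ × ℝ)).withDensity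
        fun z => gaussianPDF 0 1 z.1 * gaussianPDF 0 1 z.2 := by
      rw [planeGaussian, gaussianReal_of_var_ne_zero _ one_ne_zero,
        prod_withDensity (measurable_gaussianPDF 0 1) (measurable_gaussianPDF 0 1)]
      rfl
    have hmΘ : MeasurableSet {θ : ℝ | (Real.cos θ, Real.sin θ) ∈ s} :=
      hs.preimage (Continuous.measurable (by fun_prop))
    rw [hdens, withDensity_apply _ hs, ← lintegral_indicator hs, ← lintegral_comp_polarCoord_symm,
      polarCoord_target]
    have e : ∀ q ∈ Set.Ioi (0 : ℝ) ×ˢ Set.Ioo (-Real.pi) Real.pi,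
        ENNReal.ofReal q.1 • s.indicator
          (fun z => gaussianPDF 0 1 z.1 * gaussianPDF 0 1 z.2) (polarCoord.symm q)
        = (ENNReal.ofReal q.1
          * ENNReal.ofReal ((Real.sqrt (2 * Real.pi))⁻¹ ^ 2 * Real.exp (-q.1 ^ 2 / 2)))
          * {θ : ℝ | (Real.cos θ, Real.sin θ) ∈ s}.indicator 1 q.2 := by
      rintro ⟨r, θ⟩ ⟨hr, -⟩
      have hr : 0 < r := hr
      have hmem := hcone r hr (Real.cos θ, Real.sin θ)
      rw [polarCoord_symm_apply, smul_eq_mul, mul_assoc]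
      congr 1
      by_cases h : (Real.cos θ, Real.sin θ) ∈ s
      · rw [Set.indicator_of_mem (hmem.2 h), Set.indicator_of_mem (by exact h), Pi.one_apply,
          mul_one, gaussianPDF, gaussianPDF,
          ← ENNReal.ofReal_mul (gaussianPDFReal_nonneg _ _ _), gaussianPDFReal, gaussianPDFReal]
        congr 1
        have e2 : -r ^ 2 / 2 = -(r * Real.cos θ) ^ 2 / 2 + -(r * Real.sin θ) ^ 2 / 2 := by
          linear_combination (r ^ 2 / 2) * Real.sin_sq_add_cos_sq θ
        simp only [sub_zero, NNReal.coe_one, mul_one]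
        rw [e2, Real.exp_add]
        ring
      · rw [Set.indicator_of_notMem (fun hh => h (hmem.1 hh)), Set.indicator_of_notMem (by exact h),
          mul_zero]
    rw [setLIntegral_congr_fun (measurableSet_Ioi.prod measurableSet_Ioo) e,
      Measure.volume_eq_prod, ← Measure.prod_restrict,
      lintegral_prod_mul (f := fun r : ℝ => ENNReal.ofReal r
        * ENNReal.ofReal ((Real.sqrt (2 * Real.pi))⁻¹ ^ 2 * Real.exp (-r ^ 2 / 2)))
        (by fun_prop) (measurable_one.indicator hmΘ).aemeasurable,
      lintegral_indicator_one hmΘ, Measure.restrict_apply hmΘ, Set.inter_comm]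
  -- The radial integral `R` is never computed: the whole plane, of mass `1`, determines it.
  have h1 := key Set.univ MeasurableSet.univ (by simp)
  simp only [measure_univ, Set.mem_univ, Set.ofPred_true, Set.inter_univ] at h1
  rw [key s hs hcone, mul_right_comm, ← h1, one_mul]

/-- With `c = tan α`, `c cos θ + sin θ = sin (θ + α) / cos α`, so the condition is `cos θ sin (θ +
α) < 0`. Both arcs have length `π/2 - α = arccot c`. -/
lemma angle_set_eq {c : ℝ} (hc : 0 < c) :
    Set.Ioo (-Real.pi) Real.pi ∩ {θ | Real.cos θ * (c * Real.cos θ + Real.sin θ) < 0}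
      = Set.Ioo (-(Real.pi / 2)) (-Real.arctan c)
        ∪ Set.Ioo (Real.pi / 2) (Real.pi - Real.arctan c) := by
  set α := Real.arctan c with hα
  have hα0 : 0 < α := Real.arctan_pos.2 hc
  have hα1 : α < Real.pi / 2 := Real.arctan_lt_pi_div_two c
  have hcos : 0 < Real.cos α := Real.cos_arctan_pos c
  have hpi := Real.pi_pos
  have e : ∀ θ, c * Real.cos θ + Real.sin θ = Real.sin (θ + α) / Real.cos α := by
    intro θ
    have : c = Real.sin α / Real.cos α := by rw [← Real.tan_eq_sin_div_cos, hα, Real.tan_arctan]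
    rw [Real.sin_add, eq_div_iff hcos.ne', this]
    field_simp
    ring
  ext θ
  simp only [Set.mem_inter_iff, Set.mem_Ioo, Set.mem_ofPred_eq, Set.mem_union, e]
  rw [← mul_div_assoc, div_neg_iff]
  simp only [hcos, hcos.not_gt, and_false, false_or, and_true]
  constructor
  · rintro ⟨⟨h1, h2⟩, h3⟩
    by_contra! hno
    obtain ⟨hn1, hn2⟩ := hno
    refine h3.not_ge ?_
    rcases le_or_gt θ (-(Real.pi / 2)) with h | h
    · refine mul_nonneg_of_nonpos_of_nonpos ?_ ?_
      · rw [← Real.cos_neg]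
        exact Real.cos_nonpos_of_pi_div_two_le_of_le (by linarith) (by linarith)
      · exact Real.sin_nonpos_of_nonpos_of_neg_pi_le (by linarith) (by linarith)
    have h4 := hn1 h
    rcases le_or_gt θ (Real.pi / 2) with h5 | h5
    · exact mul_nonneg (Real.cos_nonneg_of_neg_pi_div_two_le_of_le h.le h5)
        (Real.sin_nonneg_of_nonneg_of_le_pi (by linarith) (by linarith))
    · have h6 := hn2 h5
      refine mul_nonneg_of_nonpos_of_nonpos
        (Real.cos_nonpos_of_pi_div_two_le_of_le h5.le (by linarith)) ?_
      rw [← Real.sin_sub_two_pi]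
      exact Real.sin_nonpos_of_nonpos_of_neg_pi_le (by linarith) (by linarith)
  · rintro (⟨h1, h2⟩ | ⟨h1, h2⟩)
    · refine ⟨⟨by linarith, by linarith⟩, mul_neg_of_pos_of_neg ?_ ?_⟩
      · exact Real.cos_pos_of_mem_Ioo ⟨h1, by linarith⟩
      · exact Real.sin_neg_of_neg_of_neg_pi_lt (by linarith) (by linarith)
    · refine ⟨⟨by linarith, by linarith⟩, mul_neg_of_neg_of_pos ?_ ?_⟩
      · exact Real.cos_neg_of_pi_div_two_lt_of_lt h1 (by linarith)
      · exact Real.sin_pos_of_pos_of_lt_pi (by linarith) (by linarith)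

/-- Two standard Gaussian coordinates `u`, `v` satisfy `u (c u + v) < 0` with probability
`arccot c / π`. -/
lemma planeGaussian_wedge {c : ℝ} (hc : 0 < c) :
    planeGaussian {z | z.1 * (c * z.1 + z.2) < 0} = ENNReal.ofReal (1 / Real.pi * arccot c) := by
  have hpi := Real.pi_pos
  have hα1 : Real.arctan c < Real.pi / 2 := Real.arctan_lt_pi_div_two c
  have hα0 : 0 < Real.arctan c := Real.arctan_pos.2 hc
  have hm : MeasurableSet {z : ℝ × ℝ | z.1 * (c * z.1 + z.2) < 0} :=
    measurableSet_lt (by fun_prop) (by fun_prop)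
  have h := planeGaussian_cone hm (by
    intro r hr z
    have : r * z.1 * (c * (r * z.1) + r * z.2) = (r * r) * (z.1 * (c * z.1 + z.2)) := by ring
    simp only [Set.mem_ofPred_eq, this]
    have hrr := mul_pos hr hr
    exact ⟨fun h => neg_of_mul_neg_right h hrr.le, fun h => mul_neg_of_pos_of_neg hrr h⟩)
  have e : {θ : ℝ | (Real.cos θ, Real.sin θ) ∈ {z : ℝ × ℝ | z.1 * (c * z.1 + z.2) < 0}}
      = {θ | Real.cos θ * (c * Real.cos θ + Real.sin θ) < 0} := rfl
  rw [e, angle_set_eq hc, measure_union _ measurableSet_Ioo, Real.volume_Ioo, Real.volume_Ioo,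
    Real.volume_Ioo, ← ENNReal.ofReal_add (by linarith) (by linarith)] at h
  · have h2 : ENNReal.ofReal (1 / Real.pi * arccot c) * ENNReal.ofReal (Real.pi - -Real.pi)
        = ENNReal.ofReal (-Real.arctan c - -(Real.pi / 2)
          + (Real.pi - Real.arctan c - Real.pi / 2)) := by
      rw [← ENNReal.ofReal_mul (mul_nonneg (by positivity) (by rw [arccot]; linarith)), arccot]
      congr 1
      field_simp
      ring
    rw [← h2] at h
    exact (ENNReal.mul_left_inj (by simpa using hpi) ENNReal.ofReal_ne_top).1 h
  · refine Set.disjoint_left.2 fun θ h1 h2 => ?_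
    linarith [h1.2, h2.1]

/-! ### The joint central limit theorem -/

/-- The logarithm of the characteristic function of a measurement of a positive sentiment. -/
def channelLog (p : ℝ) (z : ℂ) : ℂ :=
  Complex.log ((1 - p) * Complex.exp (Complex.I * z) + p * Complex.exp (-(Complex.I * z)))

/-- Second-order expansion at `0`: a measurement of sentiment `1` has mean `1 - 2p` and variance `1
- (1 - 2p)² = 4p(1-p)`. -/
lemma tendsto_channelLog {p : ℝ} {b : ℂ} {δ : ℕ → ℂ} (hδ : Tendsto δ atTop (𝓝 0))
    (hb : Tendsto (fun n : ℕ => n * δ n ^ 2) atTop (𝓝 b)) :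
    Tendsto (fun n : ℕ => n * (channelLog p (δ n) - (1 - 2 * p) * Complex.I * δ n)) atTop
      (𝓝 (-(4 * p * (1 - p)) / 2 * b)) ∧
    ∀ᶠ n in atTop, (1 - p) * Complex.exp (Complex.I * δ n) + p * Complex.exp (-(Complex.I * δ n))
      = Complex.exp (channelLog p (δ n)) := by
  set g : ℂ → ℂ := fun z =>
    (1 - p) * Complex.exp (Complex.I * z) + p * Complex.exp (-(Complex.I * z)) with hg
  set k : ℂ → ℂ := fun z => Complex.I *
    ((1 - p) * Complex.exp (Complex.I * z) - p * Complex.exp (-(Complex.I * z))) with hk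
  have e1 (z : ℂ) : HasDerivAt (fun z => Complex.exp (Complex.I * z))
      (Complex.I * Complex.exp (Complex.I * z)) z := by
    refine ((hasDerivAt_id z).const_mul Complex.I).cexp.congr_deriv ?_
    simp only [id]
    ring
  have e2 (z : ℂ) : HasDerivAt (fun z => Complex.exp (-(Complex.I * z)))
      (-(Complex.I * Complex.exp (-(Complex.I * z)))) z := by
    refine ((hasDerivAt_id z).const_mul Complex.I).neg.cexp.congr_deriv ?_
    simp only [id, Pi.neg_apply]
    ring
  have hgd (z : ℂ) : HasDerivAt g (k z) z := by
    refine (((e1 z).const_mul (1 - p : ℂ)).add ((e2 z).const_mul (p : ℂ))).congr_deriv ?_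
    simp only [hk]
    ring
  have hkd (z : ℂ) : HasDerivAt k (-g z) z := by
    refine ((((e1 z).const_mul (1 - p : ℂ)).sub ((e2 z).const_mul (p : ℂ))).const_mul
      Complex.I).congr_deriv ?_
    simp only [hg]
    linear_combination ((1 - p) * Complex.exp (Complex.I * z)
      + p * Complex.exp (-(Complex.I * z))) * Complex.I_mul_I
  have hg0 : g 0 = 1 := by simp [hg]
  have hk0 : k 0 = (1 - 2 * p) * Complex.I := by
    simp [hk]
    ring
  have hslit : ∀ᶠ z in 𝓝 0, g z ∈ Complex.slitPlane :=
    (hgd 0).continuousAt.eventually_mem (Complex.isOpen_slitPlane.mem_nhds (by simp [hg0]))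
  have hF : ∀ᶠ z in 𝓝 0, HasDerivAt (channelLog p) (k z / g z) z :=
    hslit.mono fun z hz => (hgd z).clog hz
  have hm : HasDerivAt (fun z => k z / g z) (-(4 * p * (1 - p))) 0 := by
    refine ((hkd 0).div (hgd 0) (by simp [hg0])).congr_deriv ?_
    rw [hg0, hk0]
    linear_combination -(1 - 2 * (p : ℂ)) ^ 2 * Complex.I_mul_I
  have hF0 : channelLog p 0 = 0 := by simp [channelLog]
  constructor
  · have := tendsto_taylor_two hF hm hδ hb
    simpa [hF0, hg0, hk0] using this
  · filter_upwards [hδ.eventually hslit] with n hn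
    exact (Complex.exp_log (Complex.slitPlane_ne_zero hn)).symm

lemma tendsto_inv_sqrt_natCast : Tendsto (fun n : ℕ => (Real.sqrt n)⁻¹) atTop (𝓝 0) :=
  tendsto_inv_atTop_zero.comp (Real.tendsto_sqrt_atTop.comp tendsto_natCast_atTop_atTop)

/-- The centred and normalized average sentiment and measurement noise. -/
def normalizedPair (p μ σ τ : ℝ) {n : ℕ} (z : Config n × Config n) : ℝ × ℝ :=
  (Real.sqrt n * (z.1.avg - μ) / σ, Real.sqrt n * (z.2.avg - (1 - 2 * p) * z.1.avg) / τ)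

/-- The characteristic function of the normalized pair. -/
lemma charFun_normalizedPair {n : ℕ} (hn : 0 < n) (A : Matrix (Fin n) (Fin n) ℝ)
    (β h p μ a b : ℝ) {σ τ : ℝ} (hσ : 0 < σ) (hτ : 0 < τ) {L : ℂ}
    (hL : (1 - p) * Complex.exp (Complex.I * ((b / τ * (Real.sqrt n)⁻¹ : ℝ) : ℂ))
      + p * Complex.exp (-(Complex.I * ((b / τ * (Real.sqrt n)⁻¹ : ℝ) : ℂ))) = Complex.exp L)
    {ε : ℝ} (hε : ε = L.im - (1 - 2 * p) * (b / τ * (Real.sqrt n)⁻¹)) {δ : ℂ}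
    (hδ : δ = Complex.I * ((ε + a / σ * (Real.sqrt n)⁻¹ : ℝ) : ℂ)) :
    ∑ z : Config n × Config n, ((isingPrior A β h z.1 * channel p z.1 z.2 : ℝ) : ℂ)
      * Complex.exp ((((normalizedPair p μ σ τ z).1 * a + (normalizedPair p μ σ τ z).2 * b : ℝ) : ℂ)
        * Complex.I)
      = Complex.exp ((n * L.re : ℝ) : ℂ)
        * (complexPartition A β (h + δ) / complexPartition A β h * Complex.exp (-(n * μ * δ)))
        * Complex.exp (Complex.I * ((μ * (n * ε) : ℝ) : ℂ)) := by
  set r := Real.sqrt n with hr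
  have hr0 : 0 < r := Real.sqrt_pos.2 (by exact_mod_cast hn)
  have hr2 : (n : ℝ) = r ^ 2 := (Real.sq_sqrt (Nat.cast_nonneg n)).symm
  set c := b / τ * r⁻¹ with hc
  -- Sentiment `-1` gives the complex conjugate. So `sum_channel_mul_exp` applies with `l = Re L`
  -- and `s = i Im L`, a purely imaginary shift of the field.
  have hL2 : (1 - p) * Complex.exp (-(Complex.I * (c : ℂ))) + p * Complex.exp (Complex.I * (c : ℂ))
      = Complex.exp (L.re - Complex.I * L.im) := by
    have := congrArg (starRingEnd ℂ) hL
    simp only [map_add, map_mul, map_sub, map_one, map_neg, ← Complex.exp_conj, Complex.conj_ofReal,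
      Complex.conj_I, neg_mul, neg_neg] at this
    rw [this]
    congr 1
    apply Complex.ext <;> simp
  have hL1 : (1 - p) * Complex.exp (Complex.I * (c : ℂ)) + p * Complex.exp (-(Complex.I * (c : ℂ)))
      = Complex.exp (L.re + Complex.I * L.im) := by
    rw [hL]
    congr 1
    apply Complex.ext <;> simp
  have hreal (x y : Config n) : (normalizedPair p μ σ τ (x, y)).1 * a
      + (normalizedPair p μ σ τ (x, y)).2 * b
      = (a / σ * r⁻¹ - (1 - 2 * p) * c) * ∑ i, x.vec i - a / σ * r * μ + c * ∑ i, y.vec i := by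
    simp only [normalizedPair, Config.avg, ← hr]
    rw [hr2, hc]
    field_simp
    ring
  have hexp (x y : Config n) : Complex.exp ((((normalizedPair p μ σ τ (x, y)).1 * a
      + (normalizedPair p μ σ τ (x, y)).2 * b : ℝ) : ℂ) * Complex.I)
      = Complex.exp (Complex.I * ((a / σ * r⁻¹ - (1 - 2 * p) * c : ℝ) : ℂ)
          * ((∑ i, x.vec i : ℝ) : ℂ)) * Complex.exp (-(Complex.I * ((a / σ * r * μ : ℝ) : ℂ)))
        * Complex.exp (Complex.I * (c : ℂ) * ((∑ i, y.vec i : ℝ) : ℂ)) := by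
    rw [hreal, ← Complex.exp_add, ← Complex.exp_add]
    congr 1
    push_cast
    ring
  have hx (x : Config n) : ∑ y : Config n, ((isingPrior A β h x * channel p x y : ℝ) : ℂ)
      * Complex.exp ((((normalizedPair p μ σ τ (x, y)).1 * a
        + (normalizedPair p μ σ τ (x, y)).2 * b : ℝ) : ℂ) * Complex.I)
      = Complex.exp (n * L.re) * Complex.exp (-(Complex.I * ((a / σ * r * μ : ℝ) : ℂ)))
        * ((isingPrior A β h x : ℂ) * Complex.exp (δ * ((∑ i, x.vec i : ℝ) : ℂ))) := by
    have h1 := sum_channel_mul_exp (n := n) hL1 hL2 x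
    have h2 : ∀ y : Config n, ((isingPrior A β h x * channel p x y : ℝ) : ℂ)
      * Complex.exp ((((normalizedPair p μ σ τ (x, y)).1 * a
        + (normalizedPair p μ σ τ (x, y)).2 * b : ℝ) : ℂ) * Complex.I)
      = (isingPrior A β h x * Complex.exp (Complex.I * ((a / σ * r⁻¹ - (1 - 2 * p) * c : ℝ) : ℂ)
          * ((∑ i, x.vec i : ℝ) : ℂ)) * Complex.exp (-(Complex.I * ((a / σ * r * μ : ℝ) : ℂ))))
        * ((channel p x y : ℂ) * Complex.exp (Complex.I * (c : ℂ) * ((∑ i, y.vec i : ℝ) : ℂ))) := by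
      intro y
      rw [hexp]
      push_cast
      ring
    have h3 : Complex.exp (δ * ((∑ i, x.vec i : ℝ) : ℂ))
        = Complex.exp (Complex.I * ((a / σ * r⁻¹ - (1 - 2 * p) * c : ℝ) : ℂ)
          * ((∑ i, x.vec i : ℝ) : ℂ))
          * Complex.exp (Complex.I * L.im * ((∑ i, x.vec i : ℝ) : ℂ)) := by
      rw [hδ, hε, ← Complex.exp_add]
      congr 1
      push_cast
      ring
    simp_rw [h2]
    rw [← Finset.mul_sum, h1, Complex.exp_add, h3]
    ring
  rw [Fintype.sum_prod_type]
  simp_rw [hx, ← Finset.mul_sum]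
  rw [sum_isingPrior_mul_exp]
  have h4 : Complex.exp (-(n * μ * δ)) * Complex.exp (Complex.I * ((μ * (n * ε) : ℝ) : ℂ))
      = Complex.exp (-(Complex.I * ((a / σ * r * μ : ℝ) : ℂ))) := by
    have h5 : (n : ℂ) = (r : ℂ) ^ 2 := by exact_mod_cast hr2
    have h6 : (r : ℂ) ≠ 0 := by exact_mod_cast hr0.ne'
    rw [hδ, ← Complex.exp_add]
    congr 1
    push_cast
    rw [h5]
    field_simp
    ring
  push_cast at h4 ⊢
  linear_combination -(Complex.exp (n * L.re)
    * (complexPartition A β (h + δ) / complexPartition A β h)) * h4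

/-- In the factorization of `charFun_normalizedPair`, the noise contributes `-b²/2` to the exponent
and the partition function ratio `-a²/2`, while the leftover phase `μ n ε` tends to `0`. -/
lemma tendsto_charFun_normalizedPair {A : ∀ n, Matrix (Fin n) (Fin n) ℝ} {β h μ p σ τ : ℝ}
    {lam m s : ℂ → ℂ} (H : IsQuasiPower (fun n => complexPartition (A n) β) lam m s h)
    (hμ : m h = μ) (hs : s h = (σ ^ 2 : ℝ)) (hσ : 0 < σ) (hτ : 0 < τ)
    (hτ2 : τ ^ 2 = 4 * p * (1 - p)) (a b : ℝ) :
    Tendsto (fun n : ℕ => ∑ z : Config n × Config n,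
      ((isingPrior (A n) β h z.1 * channel p z.1 z.2 : ℝ) : ℂ)
      * Complex.exp ((((normalizedPair p μ σ τ z).1 * a + (normalizedPair p μ σ τ z).2 * b : ℝ) : ℂ)
        * Complex.I)) atTop (𝓝 (Complex.exp (((-(a ^ 2 + b ^ 2) / 2 : ℝ) : ℂ)))) := by
  have hinv := tendsto_inv_sqrt_natCast
  have hninv : ∀ᶠ n : ℕ in atTop, (n : ℝ) * (Real.sqrt n)⁻¹ ^ 2 = 1 := by
    filter_upwards [eventually_gt_atTop 0] with n hn
    rw [inv_pow, Real.sq_sqrt (Nat.cast_nonneg n)]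
    exact mul_inv_cancel₀ (by positivity)
  set c : ℕ → ℝ := fun n => b / τ * (Real.sqrt n)⁻¹ with hc
  have hc0 : Tendsto c atTop (𝓝 0) := by simpa using hinv.const_mul (b / τ)
  have hc2 : Tendsto (fun n : ℕ => (n : ℝ) * c n ^ 2) atTop (𝓝 ((b / τ) ^ 2)) := by
    refine tendsto_const_nhds.congr' ?_
    filter_upwards [hninv] with n hn
    simp only [hc]
    linear_combination -(b / τ) ^ 2 * hn
  have hcC : Tendsto (fun n => (c n : ℂ)) atTop (𝓝 0) := by exact_mod_cast hc0.ofReal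
  have hc2C : Tendsto (fun n : ℕ => (n : ℂ) * (c n : ℂ) ^ 2) atTop (𝓝 (((b / τ) ^ 2 : ℝ) : ℂ)) := by
    exact_mod_cast hc2.ofReal
  obtain ⟨hlim, hev⟩ := tendsto_channelLog (p := p) hcC hc2C
  set L : ℕ → ℂ := fun n => channelLog p (c n) with hL
  set ε : ℕ → ℝ := fun n => (L n).im - (1 - 2 * p) * c n with hε
  have hval : -(4 * p * (1 - p)) / 2 * (((b / τ) ^ 2 : ℝ) : ℂ) = ((-(b ^ 2) / 2 : ℝ) : ℂ) := by
    have : -(4 * p * (1 - p)) / 2 * (b / τ) ^ 2 = -(b ^ 2) / 2 := by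
      rw [← hτ2]
      field_simp
    exact_mod_cast congrArg ((↑) : ℝ → ℂ) this
  rw [hval] at hlim
  have hsplit (n : ℕ) : (n : ℂ) * (channelLog p (c n) - (1 - 2 * p) * Complex.I * c n)
      = ((n * (L n).re : ℝ) : ℂ) + ((n * ε n : ℝ) : ℂ) * Complex.I := by
    apply Complex.ext <;> simp [hL, hε]
  simp_rw [hsplit] at hlim
  have hre : Tendsto (fun n : ℕ => n * (L n).re) atTop (𝓝 (-(b ^ 2) / 2)) := by
    have := (Complex.continuous_re.tendsto _).comp hlim
    refine (this.congr fun n => ?_).trans (by rw [Complex.ofReal_re])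
    simp
  -- The second-order limit is real, so the imaginary part drops out at this order.
  have him : Tendsto (fun n : ℕ => n * ε n) atTop (𝓝 0) := by
    have := (Complex.continuous_im.tendsto _).comp hlim
    refine (this.congr fun n => ?_).trans (by rw [Complex.ofReal_im])
    simp
  have hε1 : Tendsto (fun n : ℕ => (n * ε n) * (Real.sqrt n)⁻¹) atTop (𝓝 0) := by
    simpa using him.mul hinv
  have hε0 : Tendsto ε atTop (𝓝 0) := by
    have h1 : Tendsto (fun n : ℕ => (n * ε n) * (Real.sqrt n)⁻¹ * (Real.sqrt n)⁻¹) atTop (𝓝 0) := by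
      simpa using hε1.mul hinv
    refine h1.congr' ?_
    filter_upwards [hninv] with n hn
    linear_combination ε n * hn
  set d : ℕ → ℝ := fun n => ε n + a / σ * (Real.sqrt n)⁻¹ with hd
  have hd0 : Tendsto d atTop (𝓝 0) := by simpa using hε0.add (hinv.const_mul (a / σ))
  have hd2 : Tendsto (fun n : ℕ => n * d n ^ 2) atTop (𝓝 ((a / σ) ^ 2)) := by
    have h1 : Tendsto (fun n : ℕ => (n * ε n) * ε n + 2 * (a / σ) * ((n * ε n) * (Real.sqrt n)⁻¹)
        + (a / σ) ^ 2) atTop (𝓝 (0 * 0 + 2 * (a / σ) * 0 + (a / σ) ^ 2)) :=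
      ((him.mul hε0).add (hε1.const_mul _)).add_const _
    simp only [mul_zero, zero_add] at h1
    refine h1.congr' ?_
    filter_upwards [hninv] with n hn
    simp only [hd]
    linear_combination -(a / σ) ^ 2 * hn
  have hδ0 : Tendsto (fun n => Complex.I * (d n : ℂ)) atTop (𝓝 0) := by
    simpa using hd0.ofReal.const_mul Complex.I
  have hδ2 : Tendsto (fun n : ℕ => (n : ℂ) * (Complex.I * (d n : ℂ)) ^ 2) atTop
      (𝓝 (-(((a / σ) ^ 2 : ℝ) : ℂ))) := by
    refine hd2.ofReal.neg.congr fun n => ?_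
    rw [mul_pow, Complex.I_sq]
    push_cast
    ring
  have hratio := H.tendsto_ratio (fun n => differentiable_complexPartition (A n) β) hδ0 hδ2
  have h1 := hre.ofReal.cexp
  have h2 := (((him.const_mul μ).ofReal).const_mul Complex.I).cexp
  have h3 := (h1.mul hratio).mul h2
  have hfin : Complex.exp ((-(b ^ 2) / 2 : ℝ) : ℂ)
      * Complex.exp (s h / 2 * (-(((a / σ) ^ 2 : ℝ) : ℂ)))
      * Complex.exp (Complex.I * ((μ * 0 : ℝ) : ℂ))
      = Complex.exp (((-(a ^ 2 + b ^ 2) / 2 : ℝ) : ℂ)) := by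
    rw [hs, ← Complex.exp_add, ← Complex.exp_add]
    congr 1
    have : -(b ^ 2) / 2 + σ ^ 2 / 2 * (-((a / σ) ^ 2)) = -(a ^ 2 + b ^ 2) / 2 := by
      field_simp
      ring
    rw [← this]
    push_cast
    ring
  rw [hfin] at h3
  refine h3.congr' ?_
  filter_upwards [hev, eventually_gt_atTop 0] with n hn hn0
  rw [charFun_normalizedPair hn0 (A n) β h p μ a b hσ hτ hn rfl rfl, hμ]

/-! ### The error event and its limiting probability -/

/-- The planar points at which the sign of the first coordinate differs from that of
`c u + v`. -/
def errorRegion (c : ℝ) : Set (WithLp 2 (ℝ × ℝ)) :=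
  {z | SignType.sign z.fst ≠ SignType.sign (c * z.fst + z.snd)}

/-- Where the product is nonzero both signs are locally constant, so the point is interior to the
region or to its complement. -/
lemma frontier_errorRegion_subset (c : ℝ) :
    frontier (errorRegion c) ⊆ {z | z.fst * (c * z.fst + z.snd) = 0} := by
  have hcont : Continuous fun z : WithLp 2 (ℝ × ℝ) => z.fst * (c * z.fst + z.snd) := by fun_prop
  intro z hz
  by_contra h0
  rcases lt_or_gt_of_ne h0 with h | h
  · refine hz.2 (mem_interior.2 ⟨_, fun y hy => ?_, hcont.isOpen_preimage _ isOpen_Iio, h⟩)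
    have hy : y.fst * (c * y.fst + y.snd) < 0 := hy
    rcases mul_neg_iff.1 hy with ⟨h1, h2⟩ | ⟨h1, h2⟩
    · simp [errorRegion, sign_pos h1, sign_neg h2]
    · simp [errorRegion, sign_pos h2, sign_neg h1]
  · have h3 := mem_closure_iff.1 hz.1 _ (hcont.isOpen_preimage _ isOpen_Ioi) h
    obtain ⟨y, hy, hyE⟩ := h3
    have hy : 0 < y.fst * (c * y.fst + y.snd) := hy
    rcases mul_pos_iff.1 hy with ⟨h1, h2⟩ | ⟨h1, h2⟩
    · simp [errorRegion, sign_pos h1, sign_pos h2] at hyE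
    · simp [errorRegion, sign_neg h1, sign_neg h2] at hyE

lemma measurableSet_errorRegion (c : ℝ) : MeasurableSet (errorRegion c) := by
  let _ : MeasurableSpace SignType := ⊤
  have hm : Measurable (SignType.sign : ℝ → SignType) := by
    have : (SignType.sign : ℝ → SignType)
        = fun r => if 0 < r then 1 else if r < 0 then -1 else 0 := by
      funext r
      exact sign_apply
    rw [this]
    exact Measurable.ite measurableSet_Ioi measurable_const
      (Measurable.ite measurableSet_Iio measurable_const measurable_const)
  have h1 : Measurable fun z : WithLp 2 (ℝ × ℝ) => SignType.sign z.fst := hm.comp (by fun_prop)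
  have h2 : Measurable fun z : WithLp 2 (ℝ × ℝ) => SignType.sign (c * z.fst + z.snd) :=
    hm.comp (by fun_prop)
  exact (measurableSet_eq_fun h1 h2).compl

lemma planeGaussian_errorRegion {c : ℝ} (hc : 0 < c) :
    planeGaussian.map (WithLp.toLp 2) (errorRegion c) = ENNReal.ofReal (1 / Real.pi * arccot c) := by
  rw [Measure.map_apply (by fun_prop) (measurableSet_errorRegion c), ← planeGaussian_wedge hc]
  refine measure_congr ?_
  have hnull : ∀ᵐ z ∂planeGaussian, z.1 * (c * z.1 + z.2) ≠ 0 := by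
    rw [ae_iff]
    simp only [ne_eq, not_not]
    exact planeGaussian_null c
  rw [eventuallyEq_set]
  filter_upwards [hnull] with z hz
  change SignType.sign z.1 ≠ SignType.sign (c * z.1 + z.2) ↔ z.1 * (c * z.1 + z.2) < 0
  obtain ⟨h1, h2⟩ := mul_ne_zero_iff.1 hz
  rcases lt_or_gt_of_ne h1 with h1 | h1 <;> rcases lt_or_gt_of_ne h2 with h2 | h2
  · simp [sign_neg h1, sign_neg h2, (mul_pos_of_neg_of_neg h1 h2).le]
  · simp [sign_neg h1, sign_pos h2, mul_neg_of_neg_of_pos h1 h2]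
  · simp [sign_pos h1, sign_neg h2, mul_neg_of_pos_of_neg h1 h2]
  · simp [sign_pos h1, sign_pos h2, (mul_pos h1 h2).le]

lemma sign_mul_of_pos {r : ℝ} (hr : 0 < r) (x : ℝ) : SignType.sign (r * x) = SignType.sign x := by
  rw [sign_mul, sign_pos hr, one_mul]

/-- For this `c` the average `X̄` cancels from `c u + v`, leaving a positive multiple of `Ȳ - (1 -
2p) μ`. -/
lemma normalizedPair_mem_errorRegion {n : ℕ} (hn : 0 < n) {p μ σ τ c : ℝ} (hσ : 0 < σ) (hτ : 0 < τ)
    (hc : c = (1 - 2 * p) / τ * σ) (z : Config n × Config n) :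
    WithLp.toLp 2 (normalizedPair p μ σ τ z) ∈ errorRegion c
      ↔ supermajority μ z.1 ≠ detector p μ z.2 := by
  have hr : 0 < Real.sqrt n := Real.sqrt_pos.2 (by exact_mod_cast hn)
  have h1 : Real.sqrt n * (z.1.avg - μ) / σ = (Real.sqrt n / σ) * (z.1.avg - μ) := by ring
  have h2 : c * (Real.sqrt n * (z.1.avg - μ) / σ)
      + Real.sqrt n * (z.2.avg - (1 - 2 * p) * z.1.avg) / τ
      = (Real.sqrt n / τ) * (z.2.avg - (1 - 2 * p) * μ) := by
    rw [hc]
    field_simp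
    ring
  change SignType.sign (Real.sqrt n * (z.1.avg - μ) / σ)
    ≠ SignType.sign (c * (Real.sqrt n * (z.1.avg - μ) / σ)
      + Real.sqrt n * (z.2.avg - (1 - 2 * p) * z.1.avg) / τ) ↔ _
  rw [h2, h1, sign_mul_of_pos (by positivity), sign_mul_of_pos (by positivity), supermajority,
    detector]

/-- The limit of the error probability at the critical threshold. -/
lemma tendsto_errorProb_of_isQuasiPower {A : ∀ n, Matrix (Fin n) (Fin n) ℝ} {β h μ p σ : ℝ}
    {lam m s : ℂ → ℂ} (H : IsQuasiPower (fun n => complexPartition (A n) β) lam m s h)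
    (hμ : m h = μ) (hs : s h = (σ ^ 2 : ℝ)) (hσ : 0 < σ) (hp : 0 < p) (hp' : p < 1 / 2) :
    Tendsto (fun n => errorProb (A n) β h p μ) atTop
      (𝓝 (1 / Real.pi * arccot (noiseRatio p * σ))) := by
  classical
  have hτ0 : 0 < 4 * p * (1 - p) := mul_pos (by linarith) (by linarith)
  set τ := Real.sqrt (4 * p * (1 - p)) with hτ
  have hτpos : 0 < τ := Real.sqrt_pos.2 hτ0
  have hτ2 : τ ^ 2 = 4 * p * (1 - p) := Real.sq_sqrt hτ0.le
  set c := noiseRatio p * σ with hc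
  have hc0 : 0 < c := mul_pos (div_pos (by linarith) hτpos) hσ
  set w : ∀ n, Config n × Config n → ℝ :=
    fun n z => isingPrior (A n) β h z.1 * channel p z.1 z.2 with hw
  have hw0 (n : ℕ) (z : Config n × Config n) : 0 ≤ w n z :=
    mul_nonneg (isingPrior_nonneg _ _ _ _) (channel_nonneg hp.le (by linarith) _ _)
  have hw1 (n : ℕ) : ∑ z, w n z = 1 := by
    rw [Fintype.sum_prod_type]
    simp_rw [hw, ← Finset.mul_sum, sum_channel, mul_one]
    exact sum_isingPrior _ _ _
  set g : ∀ n, Config n × Config n → WithLp 2 (ℝ × ℝ) :=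
    fun n z => WithLp.toLp 2 (normalizedPair p μ σ τ z) with hg
  have hprob (n : ℕ) : IsProbabilityMeasure (discreteLaw (w n) (g n)) :=
    isProbabilityMeasure_discreteLaw (hw0 n) (hw1 n) _
  have hprob' : IsProbabilityMeasure (planeGaussian.map (WithLp.toLp 2)) :=
    Measure.isProbabilityMeasure_map (by fun_prop)
  set P : ℕ → ProbabilityMeasure (WithLp 2 (ℝ × ℝ)) :=
    fun n => ⟨discreteLaw (w n) (g n), hprob n⟩ with hP
  set P₀ : ProbabilityMeasure (WithLp 2 (ℝ × ℝ)) :=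
    ⟨planeGaussian.map (WithLp.toLp 2), hprob'⟩ with hP₀
  -- Lévy's continuity theorem; the portmanteau theorem below then gives convergence on the region,
  -- whose frontier is a null set.
  have hconv : Tendsto P atTop (𝓝 P₀) := by
    rw [ProbabilityMeasure.tendsto_iff_tendsto_charFun]
    intro t
    have h1 : charFun (P₀ : Measure (WithLp 2 (ℝ × ℝ))) t
        = Complex.exp (((-(t.fst ^ 2 + t.snd ^ 2) / 2 : ℝ) : ℂ)) := by
      change charFun (planeGaussian.map (WithLp.toLp 2)) t = _
      rw [planeGaussian, charFun_prod, charFun_gaussianReal, charFun_gaussianReal,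
        ← Complex.exp_add]
      congr 1
      simp
      ring
    rw [h1]
    refine (tendsto_charFun_normalizedPair H hμ hs hσ hτpos hτ2 t.fst t.snd).congr fun n => ?_
    change _ = charFun (discreteLaw (w n) (g n)) t
    rw [charFun_discreteLaw (hw0 n)]
    refine Finset.sum_congr rfl fun z _ => ?_
    rw [WithLp.prod_inner_apply]
    simp [hw, hg, mul_comm]
  have hfr : (P₀ : Measure (WithLp 2 (ℝ × ℝ))) (frontier (errorRegion c)) = 0 := by
    refine measure_mono_null (frontier_errorRegion_subset c) ?_
    change planeGaussian.map (WithLp.toLp 2) _ = 0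
    rw [Measure.map_apply (by fun_prop) (measurableSet_eq_fun (by fun_prop) (by fun_prop))]
    exact planeGaussian_null c
  have hlim := ProbabilityMeasure.tendsto_measure_of_null_frontier_of_tendsto' hconv hfr
  have hval : (P₀ : Measure (WithLp 2 (ℝ × ℝ))) (errorRegion c)
      = ENNReal.ofReal (1 / Real.pi * arccot c) := planeGaussian_errorRegion hc0
  rw [hval] at hlim
  have h0 : 0 ≤ 1 / Real.pi * arccot c := by
    have := Real.arctan_lt_pi_div_two c
    exact mul_nonneg (by positivity) (by rw [arccot]; linarith)
  have hlim2 := (ENNReal.tendsto_toReal ENNReal.ofReal_ne_top).comp hlim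
  rw [ENNReal.toReal_ofReal h0] at hlim2
  refine hlim2.congr' ?_
  filter_upwards [eventually_gt_atTop 0] with n hn
  change (discreteLaw (w n) (g n) (errorRegion c)).toReal = _
  rw [discreteLaw_apply (hw0 n) _ (measurableSet_errorRegion c), ENNReal.toReal_ofReal
    (Finset.sum_nonneg fun z _ => by split_ifs; exacts [hw0 n z, le_rfl]), errorProb,
    Fintype.sum_prod_type]
  refine Finset.sum_congr rfl fun x _ => Finset.sum_congr rfl fun y _ => ?_
  have := normalizedPair_mem_errorRegion hn (μ := μ) hσ hτpos (c := c) rfl (x, y)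
  simp only [hg, this, hw]

end SentimentDetection

end

theorem mainTheorem7 (F : SentimentDetection.Network) (β h p S : ℝ)
    (hβ : 0 < β) (hp : 0 ≤ p) (hp' : p < 1 / 2) (hS : -1 < S) (hS' : S < 1) :
    -- `β xᵀ A x` counts every edge twice, so the coupling per edge is `2 β`
    Tendsto (fun n : ℕ => SentimentDetection.freeEntropy (F.adjacency n) β h) atTop
      (𝓝 (F.psi (2 * β) h)) ∧
    HasDerivAt (fun t : ℝ => F.psi (2 * β) t) (F.mu (2 * β) h) h ∧
    HasDerivAt (fun t : ℝ => F.mu (2 * β) t) (F.sigmaSq (2 * β) h) h ∧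
    Tendsto (fun n : ℕ => SentimentDetection.avgMean (F.adjacency n) β h) atTop
      (𝓝 (F.mu (2 * β) h)) ∧
    Tendsto (fun n : ℕ => (n : ℝ) * SentimentDetection.avgVariance (F.adjacency n) β h) atTop
      (𝓝 (F.sigmaSq (2 * β) h)) ∧
    (S ≠ F.mu (2 * β) h →
      Tendsto (fun n : ℕ => SentimentDetection.errorProb (F.adjacency n) β h p S) atTop (𝓝 0) ∧
      limsup (fun n : ℕ => ((1 / (n : ℝ) : ℝ) : EReal) *
        ENNReal.log (ENNReal.ofReal
          (SentimentDetection.errorProb (F.adjacency n) β h p S))) atTop < 0) ∧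
    (0 < p → S = F.mu (2 * β) h →
      Tendsto (fun n : ℕ => SentimentDetection.errorProb (F.adjacency n) β h p S) atTop
        (𝓝 (1 / Real.pi * SentimentDetection.arccot
          (SentimentDetection.noiseRatio p * Real.sqrt (F.sigmaSq (2 * β) h)))) ∧
      0 < 1 / Real.pi * SentimentDetection.arccot
          (SentimentDetection.noiseRatio p * Real.sqrt (F.sigmaSq (2 * β) h))) := by
  obtain ⟨lam, m, s, H⟩ := F.isQuasiPower hβ
  obtain ⟨Hq, -, hm, hs⟩ := H h
  have hσ := F.sigmaSq_pos (2 * β) h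
  refine ⟨F.tendsto_freeEntropy hβ h, F.hasDerivAt_psi hβ h, F.hasDerivAt_mu hβ h,
    SentimentDetection.tendsto_avgMean_of_isQuasiPower Hq hm,
    SentimentDetection.tendsto_avgVariance_of_isQuasiPower Hq hs, fun hne => ?_, fun hp0 heq => ?_⟩
  · obtain ⟨ε, hε, hle⟩ := F.errorProb_le_exp hβ hp hp' hne
    exact ⟨SentimentDetection.tendsto_zero_of_le_exp
      (fun n => SentimentDetection.errorProb_nonneg _ β h S hp (by linarith)) hε hle,
      SentimentDetection.limsup_log_lt_zero_of_le_exp hε hle⟩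
  · refine ⟨?_, ?_⟩
    · rw [heq]
      exact SentimentDetection.tendsto_errorProb_of_isQuasiPower Hq hm
        (by rw [hs, Real.sq_sqrt hσ.le]) (Real.sqrt_pos.2 hσ) hp0 hp'
    · have := Real.arctan_lt_pi_div_two
        (SentimentDetection.noiseRatio p * Real.sqrt (F.sigmaSq (2 * β) h))
      exact mul_pos (by positivity) (by rw [SentimentDetection.arccot]; linarith)
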